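/- For a finite digraph $G$ with vertex set $V$ and $p\in[0,1]$, let every vertex be operational with probability $p$, independently of the others, and let the strongly connected node reliability $\mathrm{scRel}(G,p)$ be the probability that the set of operational vertices is non-empty and induces a strongly connected subdigraph of $G$. For a positive integer $n$ and a generating set $S\subseteq\mathbb{Z}_n\setminus\{0\}$ of the group $(\mathbb{Z}_n,+)$, let $\Gamma(\mathbb{Z}_n,S)$ be the directed circulant graph with vertex set $\mathbb{Z}_n$ in which there is an arc from $j$ to $i$ if and only if $i-j\in S$. **Theorem.** Let $n>9$ be odd and divisible by three, and let $2^{-1}$ be the inverse of $2$ modulo $n$. Then $\{1,3\cdot 2^{-1}\}$ is a two-element generating set of $\mathbb{Z}_n$ not containing $0$, and $G=\Gamma(\mathbb{Z}_n,\{1,3\cdot 2^{-1}\})$ is optimally-greatest for values of $p$ near one among the directed circulant graphs of the form $\Gamma(\mathbb{Z}_n,\{a,b\})$. That is, there is an $\varepsilon>0$ such that $$\mathrm{scRel}(G,p)\ \ge\ \mathrm{scRel}(\Gamma(\mathbb{Z}_n,\{a,b\}),p)$$ for all $p\in[0,1]\cap(1-\varepsilon,1+\varepsilon)$ and all generating sets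 $\{a,b\}$ of $\mathbb{Z}_n$ with $a\neq b$ and $a,b\neq 0$. -/

import Mathlib

namespace SCNodeRel

/-- A digraph is strongly connected if it has at least one vertex and there is a directed path
from every vertex to every vertex. -/
def IsStronglyConnected {V : Type*} (G : Digraph V) : Prop :=
  Nonempty V ∧ ∀ u v : V, Relation.ReflTransGen G.Adj u v

/-- The subdigraph of `G` induced by a set `S` of vertices. -/
def inducedSubdigraph {V : Type*} (G : Digraph V) (S : Finset V) : Digraph {v : V // v ∈ S} where
  Adj u v := G.Adj u.1 v.1

open Classical in
/-- The strongly connected node reliability: every vertex is operational with probability `p`,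
independently of the others, so the set of operational vertices is exactly `S` with probability
`p ^ |S| * (1 - p) ^ (|V| - |S|)`; these probabilities are added up over all `S` that induce a
strongly connected subdigraph. -/
noncomputable def nodeReliability {V : Type*} [Fintype V] (G : Digraph V) (p : ℝ) : ℝ :=
  ∑ S : Finset V with IsStronglyConnected (inducedSubdigraph G S),
    p ^ S.card * (1 - p) ^ Sᶜ.card

/-- `G` is an optimally-greatest member of the family `F` for `p` sufficiently close to `p₀`.
The radius `ε` does not depend on the competitor `H`. -/
def IsOptimallyGreatestNear {V : Type*} [Fintype V] (F : Set (Digraph V)) (p₀ : ℝ)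
    (G : Digraph V) : Prop :=
  G ∈ F ∧ ∃ ε : ℝ, 0 < ε ∧ ∀ H ∈ F, ∀ p ∈ Set.Icc (0 : ℝ) 1 ∩ Set.Ioo (p₀ - ε) (p₀ + ε),
    nodeReliability H p ≤ nodeReliability G p

/-- The directed circulant graph `Γ(ℤ_n, S)`: there is an arc from `j` to `i` iff `i - j ∈ S`. -/
def circulant (n : ℕ) (S : Set (ZMod n)) : Digraph (ZMod n) where
  Adj j i := i - j ∈ S

/-- A generating set of `ℤ_n` that does not contain the identity element. -/
def IsGeneratingSet {n : ℕ} (S : Set (ZMod n)) : Prop :=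
  0 ∉ S ∧ AddSubgroup.closure S = ⊤

/-- The directed circulant graphs `Γ(ℤ_n, {a, b})` with a two-element generating set `{a, b}`. -/
def twoCirculants (n : ℕ) : Set (Digraph (ZMod n)) :=
  {G | ∃ a b : ZMod n, a ≠ b ∧ IsGeneratingSet {a, b} ∧ G = circulant n {a, b}}

end SCNodeRel

/-! Write the reliability in powers of `1 - p`: the coefficients count the `k`-sets whose removal
leaves a strongly connected digraph. Near `p = 1` two digraphs compare lexicographically by these
counts. Since the family is finite, pairwise comparison suffices. Multiplying by the unit 2 turns
the optimal graph into Γ(ℤ_n, {2, 3}), and the comparison is decided by the counts for `k ≤ 5`.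

If at least two vertices remain, a removable set must be closed (`IsCutClosed`): no surviving vertex
loses both out-neighbours or both in-neighbours. With `d = b - a`, closed sets are of two kinds.
Those without difference `d` are the independent sets in a union of cycles whose length is the order
of `d`. When `a + b ≠ 0`, every other closed set contains a four-element block.

For the first kind, the counts up to `k = 4` do not depend on `d` once its order is at least five,
and those for `k = 5` vary by at most `n / 5`. Order three already loses at `k = 3`. Even orders do
not occur because `n` is odd. For the second kind, blocks contribute at most `n` sets for `k = 4`, a
bound that {2, 3} attains. For `k = 5` a block gets one further vertex, which must not create
another forcing pair. The block of {2, 3} is so compact that only eight displacements are forbidden,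
so it yields at least `n (n - 8)` sets. Every rival with `a + b ≠ 0` and `d` not of order three that
is not isomorphic to it yields at most `n (n - 9)`.

Finally, for {2, 3} closedness is also sufficient, except for cosets of the subgroup generated by 3.
These matter at `k = 5` only if `n = 15`, and then cost at most three sets. As `n ≥ 15`, the gain
`n` exceeds `n / 5 + 3`. The bidirected cycle, `a + b = 0`, loses at `k = 2`. -/

namespace SCNodeRel

/-! ### Reliability near one as a lexicographic comparison of counts. -/

open Classical in
/-- The number of `k`-element vertex sets whose removal leaves a strongly connected digraph. -/
noncomputable def strongCutCount {V : Type*} [Fintype V] (G : Digraph V) (k : ℕ) : ℕ :=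
  (Finset.univ.filter fun S : Finset V =>
    S.card = k ∧ IsStronglyConnected (inducedSubdigraph G Sᶜ)).card

theorem nodeReliability_eq_sum_strongCutCount {V : Type*} [Fintype V] (G : Digraph V) (p : ℝ) :
    nodeReliability G p = ∑ k ∈ Finset.range (Fintype.card V + 1),
      (strongCutCount G k : ℝ) * (p ^ (Fintype.card V - k) * (1 - p) ^ k) := by
  classical
  have h1 : nodeReliability G p =
      ∑ S ∈ Finset.univ.filter fun S : Finset V =>
        IsStronglyConnected (inducedSubdigraph G Sᶜ),
        p ^ (Fintype.card V - S.card) * (1 - p) ^ S.card := by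
    unfold nodeReliability
    refine Finset.sum_nbij' (fun S => Sᶜ) (fun S => Sᶜ) ?_ ?_ ?_ ?_ ?_
    · intro S hS
      refine Finset.mem_filter.2 ⟨Finset.mem_univ _, ?_⟩
      rw [compl_compl]
      exact (Finset.mem_filter.1 hS).2
    · intro S hS
      exact Finset.mem_filter.2 ⟨Finset.mem_univ _, (Finset.mem_filter.1 hS).2⟩
    · intro S _
      simp
    · intro S _
      simp
    · intro S _
      congr 2
      rw [Finset.card_compl]
      have := Finset.card_le_univ S
      omega
  rw [h1, ← Finset.sum_fiberwise_of_maps_to (g := Finset.card)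
    (t := Finset.range (Fintype.card V + 1))]
  · refine Finset.sum_congr rfl fun k _ => ?_
    have h2 : ∀ S ∈ (Finset.univ.filter fun S : Finset V =>
        IsStronglyConnected (inducedSubdigraph G Sᶜ)).filter (fun S => S.card = k),
        p ^ (Fintype.card V - S.card) * (1 - p) ^ S.card
          = p ^ (Fintype.card V - k) * (1 - p) ^ k := by
      intro S hS
      rw [(Finset.mem_filter.1 hS).2]
    rw [Finset.sum_congr rfl h2, Finset.sum_const, nsmul_eq_mul, Finset.filter_filter,
      strongCutCount]
    congr 4
    ext S
    exact and_comm
  · intro S _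
    have := Finset.card_le_univ S
    simp only [Finset.mem_range]
    omega

theorem IsStronglyConnected.of_equiv {V W : Type*} {G : Digraph V} {H : Digraph W} (e : V ≃ W)
    (he : ∀ u v, G.Adj u v → H.Adj (e u) (e v)) (hG : IsStronglyConnected G) :
    IsStronglyConnected H := by
  refine ⟨hG.1.map e, fun u v => ?_⟩
  have := (hG.2 (e.symm u) (e.symm v)).lift (p := H.Adj) e he
  simpa [Function.onFun] using this

theorem strongCutCount_le_of_equiv {V : Type*} [Fintype V] {G H : Digraph V} (e : V ≃ V)
    (he : ∀ u v, G.Adj u v → H.Adj (e u) (e v)) (k : ℕ) :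
    strongCutCount G k ≤ strongCutCount H k := by
  classical
  refine Finset.card_le_card_of_injOn (fun S => S.map e.toEmbedding) ?_
    (fun S _ T _ h => Finset.map_injective _ h)
  intro S hS
  simp only [Finset.coe_filter, Finset.mem_univ, true_and, Set.mem_ofPred_eq,
    Finset.card_map] at hS ⊢
  refine ⟨hS.1, hS.2.of_equiv (e.subtypeEquiv fun v => ?_) fun u v huv => he _ _ huv⟩
  simp

theorem nodeReliability_eq_of_equiv {V : Type*} [Fintype V] {G H : Digraph V} (e : V ≃ V)
    (he : ∀ u v, G.Adj u v ↔ H.Adj (e u) (e v)) (p : ℝ) :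
    nodeReliability G p = nodeReliability H p := by
  rw [nodeReliability_eq_sum_strongCutCount, nodeReliability_eq_sum_strongCutCount]
  refine Finset.sum_congr rfl fun k _ => ?_
  rw [le_antisymm (strongCutCount_le_of_equiv e (fun u v => (he u v).1) k)
    (strongCutCount_le_of_equiv e.symm (fun u v h => (he _ _).2 (by simpa using h)) k)]

/-- Multiplication by a unit is an isomorphism of circulant digraphs. -/
theorem nodeReliability_circulant_unit_mul {n : ℕ} [NeZero n] (u : (ZMod n)ˣ) (a b : ZMod n)
    (p : ℝ) :
    nodeReliability (circulant n {↑u * a, ↑u * b}) p = nodeReliability (circulant n {a, b}) p := by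
  symm
  refine nodeReliability_eq_of_equiv u.mulLeft (fun x y => ?_) p
  simp [circulant, ← mul_sub]

open Filter Topology in
/-- A polynomial in Bernstein form whose first non-vanishing coefficient is positive is
non-negative to the right of `0`. -/
theorem eventually_bernstein_sum_nonneg (N k : ℕ) (hk : k ≤ N) (c : ℕ → ℝ)
    (hc : ∀ j < k, 0 ≤ c j) (hck : 0 < c k) :
    ∀ᶠ q in 𝓝[≥] (0 : ℝ), 0 ≤ ∑ j ∈ Finset.range (N + 1), c j * ((1 - q) ^ (N - j) * q ^ j) := by
  -- The tail of the sum with `q ^ k` factored out; it is continuous with value `c k > 0` at 0,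
  -- hence positive nearby.
  set h : ℝ → ℝ := fun q => ∑ i ∈ Finset.range (N + 1 - k),
    c (k + i) * ((1 - q) ^ (N - (k + i)) * q ^ i) with hh
  have hcont : Continuous h := by fun_prop
  have h0 : h 0 = c k := by
    rw [hh]
    simp only
    rw [Finset.sum_eq_single 0]
    · simp
    · intro i _ hi
      simp [hi]
    · intro hi
      simp at hi
      omega
  have hpos : ∀ᶠ q in 𝓝 (0 : ℝ), 0 < h q := by
    apply hcont.continuousAt.eventually_const_lt
    rwa [h0]
  have hlt : ∀ᶠ q in 𝓝 (0 : ℝ), q < 1 := eventually_lt_nhds one_pos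
  filter_upwards [self_mem_nhdsWithin, nhdsWithin_le_nhds hpos, nhdsWithin_le_nhds hlt]
    with q hq0 hq1 hq2
  have hq0 : 0 ≤ q := hq0
  have hsplit : N + 1 = k + (N + 1 - k) := by omega
  rw [hsplit, Finset.sum_range_add]
  refine add_nonneg (Finset.sum_nonneg fun j hj => ?_) ?_
  · have h1 : 0 ≤ 1 - q := by linarith
    exact mul_nonneg (hc j (Finset.mem_range.1 hj)) (by positivity)
  · have : ∑ i ∈ Finset.range (N + 1 - k), c (k + i) * ((1 - q) ^ (N - (k + i)) * q ^ (k + i))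
        = q ^ k * h q := by
      rw [hh]
      simp only
      rw [Finset.mul_sum]
      refine Finset.sum_congr rfl fun i _ => ?_
      rw [pow_add]
      ring
    rw [this]
    positivity

-- With `q = 1 - p` the difference of the reliabilities is a Bernstein sum whose coefficients are
-- the differences of the cut counts. Hence the first strict inequality decides, provided no earlier
-- count goes the other way.
open Filter Topology in
theorem eventually_nodeReliability_le {V : Type*} [Fintype V] {G H : Digraph V} (k : ℕ)
    (hk : k ≤ Fintype.card V) (hle : ∀ j < k, strongCutCount H j ≤ strongCutCount G j)
    (hlt : strongCutCount H k < strongCutCount G k) :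
    ∀ᶠ p in 𝓝[≤] (1 : ℝ), nodeReliability H p ≤ nodeReliability G p := by
  have key := eventually_bernstein_sum_nonneg (Fintype.card V) k hk
    (fun j => (strongCutCount G j : ℝ) - strongCutCount H j)
    (fun j hj => sub_nonneg.2 (by exact_mod_cast hle j hj))
    (sub_pos.2 (by exact_mod_cast hlt))
  have ht : Tendsto (fun p : ℝ => 1 - p) (𝓝[≤] 1) (𝓝[≥] 0) := by
    refine tendsto_nhdsWithin_iff.2 ⟨?_, ?_⟩
    · have : Tendsto (fun p : ℝ => 1 - p) (𝓝 1) (𝓝 (1 - 1)) :=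
        (continuous_const.sub continuous_id).tendsto 1
      rw [sub_self] at this
      exact this.mono_left nhdsWithin_le_nhds
    · filter_upwards [self_mem_nhdsWithin] with p hp
      exact sub_nonneg.2 (Set.mem_Iic.1 hp)
  filter_upwards [ht.eventually key] with p hp
  rw [← sub_nonneg, nodeReliability_eq_sum_strongCutCount, nodeReliability_eq_sum_strongCutCount,
    ← Finset.sum_sub_distrib]
  refine hp.trans_eq (Finset.sum_congr rfl fun j _ => ?_)
  rw [sub_sub_cancel]
  ring

open Filter Topology in
/-- In a finite family, being eventually at least as reliable as every member gives a radius that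
serves all members. -/
theorem isOptimallyGreatestNear_one_of_eventually {V : Type*} [Fintype V] {F : Set (Digraph V)}
    (hF : F.Finite) {G : Digraph V} (hG : G ∈ F)
    (h : ∀ H ∈ F, ∀ᶠ p in 𝓝[≤] (1 : ℝ), nodeReliability H p ≤ nodeReliability G p) :
    IsOptimallyGreatestNear F 1 G := by
  refine ⟨hG, ?_⟩
  have := (Filter.eventually_all_finite hF).2 h
  rw [eventually_nhdsWithin_iff, Metric.eventually_nhds_iff] at this
  obtain ⟨ε, hε, hp⟩ := this
  refine ⟨ε, hε, fun H hH p hpp => hp ?_ hpp.1.2 H hH⟩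
  rw [Real.dist_eq, abs_lt]
  constructor <;> linarith [hpp.2.1, hpp.2.2]

/-! ### Closedness, a local necessary condition for strong connectivity. -/

/-- `S` is closed for the connection set `{a, b}` if, whenever it contains both out-neighbours
`x`, `x + (b - a)` of the vertex `x - a`, which are the two in-neighbours of `x + b`, it contains
these two vertices as well. Equivalently, in the complement of `S` every vertex keeps an
out-neighbour and an in-neighbour. -/
def IsCutClosed {n : ℕ} (a b : ZMod n) (S : Finset (ZMod n)) : Prop :=
  ∀ x ∈ S, x + (b - a) ∈ S → x - a ∈ S ∧ x + b ∈ S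

/-- A surviving vertex needs a surviving out-neighbour and in-neighbour as soon as another vertex
survives; the size bound provides that other vertex. -/
theorem isCutClosed_of_isStronglyConnected {n : ℕ} [NeZero n] {a b : ZMod n}
    {S : Finset (ZMod n)} (hS : S.card + 2 ≤ n)
    (h : IsStronglyConnected (inducedSubdigraph (circulant n {a, b}) Sᶜ)) :
    IsCutClosed a b S := by
  have hcard : 1 < (Sᶜ).card := by
    rw [Finset.card_compl, ZMod.card]
    omega
  intro x hx hxd
  constructor
  · by_contra hv
    have hv' : x - a ∈ Sᶜ := Finset.mem_compl.2 hv
    obtain ⟨w, hw, hwv⟩ := Finset.exists_mem_ne hcard (x - a)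
    rcases (h.2 ⟨x - a, hv'⟩ ⟨w, hw⟩).cases_head with heq | ⟨⟨c, hc⟩, hadj, -⟩
    · exact hwv (congrArg Subtype.val heq).symm
    · rw [Finset.mem_compl] at hc
      rcases hadj with hadj | hadj
      · exact hc (by rwa [show c = x by linear_combination hadj])
      · have hadj : c - (x - a) = b := hadj
        exact hc (by rwa [show c = x + (b - a) by linear_combination hadj])
  · by_contra hv
    have hv' : x + b ∈ Sᶜ := Finset.mem_compl.2 hv
    obtain ⟨w, hw, hwv⟩ := Finset.exists_mem_ne hcard (x + b)
    rcases (h.2 ⟨w, hw⟩ ⟨x + b, hv'⟩).cases_tail with heq | ⟨⟨c, hc⟩, -, hadj⟩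
    · exact hwv (congrArg Subtype.val heq).symm
    · rw [Finset.mem_compl] at hc
      rcases hadj with hadj | hadj
      · exact hc (by rwa [show c = x + (b - a) by linear_combination -hadj])
      · have hadj : x + b - c = b := hadj
        exact hc (by rwa [show c = x by linear_combination -hadj])

/-! ### Sufficiency of closedness for the connection set {2, 3}. -/

/-- A sequence of letters `A`, `R`, `S` in which no `R` comes two or three places after an `A`,
and every two consecutive letters `S` come with a letter `S` two places before and two places
after them. -/
structure IsCutWord (A R S : ℕ → Prop) : Prop where
  letter : ∀ j, (A j ∧ ¬R j ∧ ¬S j) ∨ (¬A j ∧ R j ∧ ¬S j) ∨ (¬A j ∧ ¬R j ∧ S j)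
  two : ∀ j, A j → ¬R (j + 2)
  three : ∀ j, A j → ¬R (j + 3)
  after : ∀ j, S j → S (j + 1) → S (j + 3)
  before : ∀ j, S (j + 2) → S (j + 3) → S j

namespace IsCutWord

variable {A R S : ℕ → Prop}

/-- Read backwards from the `R`. Before meeting an adjacent `A` or an earlier `R`, one could only
meet a run of letters `S`. An `A` cannot stand two or three places before an `R`, and a run of three
would force, by `after`, an `S` where the `R` is. -/
theorem exists_adjacent (h : IsCutWord A R S) {u : ℕ} (hu : A u) (k : ℕ) (hv : R (u + k)) :
    ∃ j, u ≤ j ∧ j < u + k ∧ A j ∧ R (j + 1) := by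
  induction k using Nat.strong_induction_on with
  | _ k ih =>
    have step : ∀ m < k, R (u + m) → ∃ j, u ≤ j ∧ j < u + k ∧ A j ∧ R (j + 1) := by
      intro m hm hR
      obtain ⟨j, h1, h2, h3⟩ := ih m hm hR
      exact ⟨j, h1, by omega, h3⟩
    obtain _ | k := k
    · have := h.letter u
      simp only [add_zero] at hv
      tauto
    rcases h.letter (u + k) with ⟨h0, -, -⟩ | ⟨-, h0, -⟩ | ⟨h0, -, h1⟩
    · exact ⟨u + k, by omega, by omega, h0, hv⟩
    · exact step k (by omega) h0
    obtain _ | k := k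
    · exact absurd hu h0
    rcases h.letter (u + k) with ⟨h2, -, -⟩ | ⟨-, h2, -⟩ | ⟨h2, -, h3⟩
    · exact absurd hv (h.two _ h2)
    · exact step k (by omega) h2
    obtain _ | k := k
    · exact absurd hu h2
    rcases h.letter (u + k) with ⟨h4, -, -⟩ | ⟨-, h4, -⟩ | ⟨-, -, h4⟩
    · exact absurd hv (h.three _ h4)
    · exact step k (by omega) h4
    · have h5 := h.after _ h4 h3
      have h6 := h.letter (u + k + 3)
      have hv' : R (u + k + 3) := hv
      tauto

/-- An adjacent pair `AR` reproduces itself exactly three places later, so the word becomes periodic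
with pattern `ARS`. The later `R` guarantees that a next pair exists. -/
theorem next_adjacent (h : IsCutWord A R S) {i : ℕ} (hA : A i) (hR : R (i + 1)) {r : ℕ}
    (hr : i + 3 < r) (hRr : R r) : S (i + 2) ∧ A (i + 3) ∧ R (i + 4) := by
  classical
  have hR2 := h.two i hA
  have hR3 := h.three i hA
  have hSi : ¬ (S (i + 2) ∧ S (i + 3)) := by
    rintro ⟨h2, h3⟩
    have := h.before i h2 h3
    have := h.letter i
    tauto
  obtain ⟨u, hu, hAu⟩ : ∃ u, (u = i + 2 ∨ u = i + 3) ∧ A u := by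
    have h2 := h.letter (i + 2)
    have h3 := h.letter (i + 3)
    by_cases hA2 : A (i + 2)
    · exact ⟨_, Or.inl rfl, hA2⟩
    · exact ⟨i + 3, Or.inr rfl, by tauto⟩
  -- Take the first pair `AR` after the given one. By symmetry with the choice of `u`, one of the
  -- two letters before it is an `R`, called `v` below.
  have hex : ∃ j, i + 2 ≤ j ∧ A j ∧ R (j + 1) := by
    obtain ⟨k, rfl⟩ : ∃ k, r = u + k := ⟨r - u, by omega⟩
    obtain ⟨j, h1, -, h2⟩ := h.exists_adjacent hAu k hRr
    exact ⟨j, by omega, h2⟩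
  obtain ⟨hj, hAj, hRj⟩ := Nat.find_spec hex
  have hmin : ∀ m, m < Nat.find hex → ¬ (i + 2 ≤ m ∧ A m ∧ R (m + 1)) :=
    fun m hm => Nat.find_min hex hm
  generalize Nat.find hex = j at *
  obtain ⟨j, rfl⟩ : ∃ l, j = l + 2 := ⟨j - 2, by omega⟩
  have hA0 : ¬ A j := fun h0 => h.three j h0 hRj
  have hA1 : ¬ A (j + 1) := fun h1 => h.two (j + 1) h1 hRj
  have hSj : ¬ (S j ∧ S (j + 1)) := by
    rintro ⟨h2, h3⟩
    have := h.after j h2 h3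
    have := h.letter (j + 3)
    tauto
  obtain ⟨v, hv, hRv⟩ : ∃ v, (v = j ∨ v = j + 1) ∧ R v := by
    have h2 := h.letter j
    have h3 := h.letter (j + 1)
    by_cases hR0 : R j
    · exact ⟨_, Or.inl rfl, hR0⟩
    · exact ⟨j + 1, Or.inr rfl, by tauto⟩
  -- If `v` came after `u`, there would be a pair `AR` between them, contradicting minimality. This
  -- leaves three possible positions, of which only distance three survives.
  have hvu : v ≤ u := by
    by_contra! hlt
    obtain ⟨k, rfl⟩ : ∃ k, v = u + k := ⟨v - u, by omega⟩
    obtain ⟨m, h1, h2, h3⟩ := h.exists_adjacent hAu k hRv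
    exact hmin m (by omega) ⟨by omega, h3⟩
  have hne : v ≠ u := by
    rintro rfl
    have := h.letter v
    tauto
  have hcases : j = i ∨ j = i + 1 ∨ j = i + 2 := by omega
  rcases hcases with rfl | rfl | rfl
  · exact absurd hRj hR3
  · exact ⟨(((h.letter (i + 2)).resolve_left fun h2 => hA1 h2.1).resolve_left
      fun h2 => hR2 h2.2.1).2.2, hAj, hRj⟩
  · exact absurd ⟨(((h.letter (i + 2)).resolve_left fun h2 => hA0 h2.1).resolve_left
      fun h2 => hR2 h2.2.1).2.2, (((h.letter (i + 3)).resolve_left fun h2 => hA1 h2.1).resolve_left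
      fun h2 => hR3 h2.2.1).2.2⟩ hSi

end IsCutWord

/-- Removing a closed set from `Γ(ℤ_n, {2, 3})` leaves a strongly connected digraph, unless the
removed set is a coset of the subgroup generated by `3`. -/
theorem isStronglyConnected_or_coset {n : ℕ} [NeZero n] (hn : 3 < n) {S : Finset (ZMod n)}
    (hS : IsCutClosed 2 3 S) (hcard : S.card < n) :
    IsStronglyConnected (inducedSubdigraph (circulant n {2, 3}) Sᶜ) ∨
      ∃ c : ZMod n, ∀ k : ℕ, c + 3 * k ∈ S ∧ c + 1 + 3 * k ∉ S ∧ c + 2 + 3 * k ∉ S := by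
  classical
  by_contra! hcon
  obtain ⟨hns, hnc⟩ := hcon
  have hne : (Sᶜ).Nonempty := by
    rw [← Finset.card_pos, Finset.card_compl, ZMod.card]
    omega
  have hnot : ∃ u v : {x // x ∈ Sᶜ}, ¬ Relation.ReflTransGen
      (inducedSubdigraph (circulant n {2, 3}) Sᶜ).Adj u v := by
    by_contra! hall
    exact hns ⟨hne.to_subtype, hall⟩
  obtain ⟨u, v, huv⟩ := hnot
  -- Letter `A` means reachable from `u`, `R` means kept but unreachable, `S` means removed. The
  -- word is read along the cycle ℤ_n in steps of 1.
  set A : ZMod n → Prop := fun x => ∃ hx : x ∈ Sᶜ, Relation.ReflTransGen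
      (inducedSubdigraph (circulant n {2, 3}) Sᶜ).Adj u ⟨x, hx⟩ with hA
  have hAS : ∀ x, A x → x ∉ S := fun x hx => Finset.mem_compl.1 hx.1
  have hadj : ∀ x y, A x → y ∉ S → y - x ∈ ({2, 3} : Set (ZMod n)) → A y := by
    rintro x y ⟨hx, hux⟩ hy hxy
    exact ⟨Finset.mem_compl.2 hy, hux.tail hxy⟩
  have hAu : A u.1 := ⟨u.2, .refl⟩
  have hAv : ¬ A v.1 := fun h => huv h.2
  have hvS : v.1 ∉ S := Finset.mem_compl.1 v.2
  have hword : ∀ w : ZMod n, IsCutWord (fun j => A (w + j)) (fun j => ¬ A (w + j) ∧ w + j ∉ S)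
      (fun j => w + j ∈ S) := by
    intro w
    refine ⟨fun j => ?_, fun j hj hR => ?_, fun j hj hR => ?_, fun j h0 h1 => ?_,
      fun j h0 h1 => ?_⟩
    · have := hAS (w + j)
      tauto
    · exact hR.1 (hadj _ _ hj hR.2 (Or.inl (by push_cast; ring)))
    · refine hR.1 (hadj _ _ hj hR.2 (Or.inr ?_))
      rw [Set.mem_singleton_iff]
      push_cast
      ring
    · have := (hS _ h0 (by convert h1 using 1; push_cast; ring)).2
      convert this using 1
      push_cast
      ring
    · have := (hS _ h0 (by convert h1 using 1; push_cast; ring)).1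
      convert this using 1
      push_cast
      ring
  have hstep : ∀ i : ZMod n, A i → ¬ A (i + 1) → i + 1 ∉ S →
      i + 2 ∈ S ∧ A (i + 3) ∧ ¬ A (i + 4) ∧ i + 4 ∉ S := by
    intro i h0 h1 h2
    -- The word has period `n`, so the `R` at place 1 recurs at place `n + 1` and serves as the
    -- required later `R`.
    have := (hword i).next_adjacent (i := 0) (by simpa using h0) (by simpa using ⟨h1, h2⟩)
      (r := n + 1) (by omega) (by simpa using ⟨h1, h2⟩)
    simpa using this
  obtain ⟨i, h0, h1, h2⟩ : ∃ i, A i ∧ ¬ A (i + 1) ∧ i + 1 ∉ S := by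
    have hv : u.1 + ((v.1 - u.1).val : ZMod n) = v.1 := by
      rw [ZMod.natCast_zmod_val]
      ring
    obtain ⟨j, -, -, h3, h4⟩ := (hword u.1).exists_adjacent (u := 0) (by simpa using hAu)
      (v.1 - u.1).val (by simpa [hv] using ⟨hAv, hvS⟩)
    refine ⟨u.1 + j, h3, ?_⟩
    simpa [add_assoc] using h4
  have hall : ∀ k : ℕ, A (i + 3 * k) ∧ ¬ A (i + 3 * k + 1) ∧ i + 3 * k + 1 ∉ S := by
    intro k
    induction k with
    | zero => simpa using ⟨h0, h1, h2⟩
    | succ k ih =>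
      have := (hstep _ ih.1 ih.2.1 ih.2.2).2
      push_cast
      rwa [show i + 3 * ((k : ZMod n) + 1) = i + 3 * k + 3 by ring,
        show i + 3 * (k : ZMod n) + 3 + 1 = i + 3 * k + 4 by ring]
  -- The pattern `ARS` repeats all around the cycle, so the removed vertices are exactly the coset
  -- of `i + 2`, which was excluded.
  obtain ⟨k, hk⟩ := hnc (i + 2)
  obtain ⟨h3, h4, h5⟩ := hall k
  obtain ⟨h6, h7, h8, h9⟩ := hstep _ h3 h4 h5
  have h10 := hk (by rwa [show i + 2 + 3 * (k : ZMod n) = i + 3 * k + 2 by ring])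
    (by rw [show i + 2 + 1 + 3 * (k : ZMod n) = i + 3 * k + 3 by ring]; exact hAS _ h7)
  rw [show i + 2 + 2 + 3 * (k : ZMod n) = i + 3 * k + 4 by ring] at h10
  exact h9 h10

/-! ### Counting the sets that avoid a difference. -/

open Classical in
/-- The `k`-element sets with the property `P`. -/
noncomputable def cardFamily {α : Type*} [Fintype α] (k : ℕ) (P : Finset α → Prop) :
    Finset (Finset α) :=
  Finset.univ.filter fun S => S.card = k ∧ P S

@[simp]
theorem mem_cardFamily {α : Type*} [Fintype α] {k : ℕ} {P : Finset α → Prop} {S : Finset α} :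
    S ∈ cardFamily k P ↔ S.card = k ∧ P S := by
  simp [cardFamily]

open Classical in
/-- Double counting of the pairs `z ∈ T` with `T` a `(k + 1)`-element member of a family that is
closed under subsets. -/
theorem succ_mul_card_cardFamily {α : Type*} [Fintype α] [DecidableEq α] {P : Finset α → Prop}
    (hP : ∀ S T, S ⊆ T → P T → P S) (k : ℕ) :
    (k + 1) * (cardFamily (k + 1) P).card =
      ∑ S ∈ cardFamily k P, (Finset.univ.filter fun z => z ∉ S ∧ P (insert z S)).card := by
  have h1 : (k + 1) * (cardFamily (k + 1) P).card = ∑ T ∈ cardFamily (k + 1) P, T.card := by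
    rw [Finset.sum_congr rfl fun T hT => (mem_cardFamily.1 hT).1, Finset.sum_const, smul_eq_mul,
      mul_comm]
  rw [h1, ← Finset.card_sigma, ← Finset.card_sigma]
  refine Finset.card_nbij' (fun p => ⟨p.1.erase p.2, p.2⟩) (fun p => ⟨insert p.2 p.1, p.2⟩)
    ?_ ?_ ?_ ?_
  · rintro ⟨T, z⟩ hT
    simp only [Finset.coe_sigma, Set.mem_sigma_iff, Finset.mem_coe, mem_cardFamily,
      Finset.mem_filter, Finset.mem_univ, true_and] at hT ⊢
    refine ⟨⟨?_, hP _ _ (Finset.erase_subset _ _) hT.1.2⟩, Finset.notMem_erase _ _, ?_⟩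
    · rw [Finset.card_erase_of_mem hT.2, hT.1.1]
      rfl
    · rw [Finset.insert_erase hT.2]
      exact hT.1.2
  · rintro ⟨S, z⟩ hS
    simp only [Finset.coe_sigma, Set.mem_sigma_iff, Finset.mem_coe, mem_cardFamily,
      Finset.mem_filter, Finset.mem_univ, true_and] at hS ⊢
    exact ⟨⟨by rw [Finset.card_insert_of_notMem hS.2.1, hS.1.1], hS.2.2⟩,
      Finset.mem_insert_self _ _⟩
  · rintro ⟨T, z⟩ hT
    simp only [Finset.coe_sigma, Set.mem_sigma_iff, Finset.mem_coe] at hT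
    simp [Finset.insert_erase hT.2]
  · rintro ⟨S, z⟩ hS
    simp only [Finset.coe_sigma, Set.mem_sigma_iff, Finset.mem_coe, Finset.mem_filter,
      Finset.mem_univ, true_and] at hS
    simp [Finset.erase_insert hS.2.1]

theorem card_cardFamily_zero {α : Type*} [Fintype α] {P : Finset α → Prop} (hP : P ∅) :
    (cardFamily 0 P).card = 1 := by
  rw [Finset.card_eq_one]
  refine ⟨∅, ?_⟩
  ext S
  simp only [mem_cardFamily, Finset.card_eq_zero, Finset.mem_singleton]
  exact ⟨fun h => h.1, fun h => ⟨h, h ▸ hP⟩⟩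

/-- `S` contains no two elements with difference `d`. -/
def AvoidsDiff {n : ℕ} (d : ZMod n) (S : Finset (ZMod n)) : Prop :=
  ∀ x ∈ S, x + d ∉ S

theorem AvoidsDiff.mono {n : ℕ} {d : ZMod n} (S T : Finset (ZMod n)) (hST : S ⊆ T)
    (hT : AvoidsDiff d T) : AvoidsDiff d S :=
  fun x hx hxd => hT x (hST hx) (hST hxd)

theorem avoidsDiff_insert {n : ℕ} {d : ZMod n} (hd : d ≠ 0) {S : Finset (ZMod n)}
    (hS : AvoidsDiff d S) (z : ZMod n) :
    AvoidsDiff d (insert z S) ↔ z + d ∉ S ∧ z - d ∉ S := by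
  constructor
  · intro h
    refine ⟨fun h1 => h z (Finset.mem_insert_self _ _) (Finset.mem_insert_of_mem h1), fun h1 => ?_⟩
    refine h (z - d) (Finset.mem_insert_of_mem h1) ?_
    simp
  · rintro ⟨h1, h2⟩ x hx hxd
    rw [Finset.mem_insert] at hx hxd
    rcases hx with rfl | hx
    · rcases hxd with hxd | hxd
      · exact hd (by linear_combination hxd)
      · exact h1 hxd
    · rcases hxd with hxd | hxd
      · exact h2 (by rwa [← hxd, add_sub_cancel_right])
      · exact hS x hx hxd

/-- The number of `k`-element subsets of `ℤ_n` without two elements of difference `d`. -/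
noncomputable def avoidCount {n : ℕ} [NeZero n] (d : ZMod n) (k : ℕ) : ℕ :=
  (cardFamily k (AvoidsDiff d)).card

/-- The points that cannot be added are those of `S`, `S + d` and `S - d`. The first is disjoint
from the others, and the overlap of the last two corresponds to the pairs `x`, `x + 2 * d` in `S`.
-/
theorem card_extensions {n : ℕ} [NeZero n] {d : ZMod n} {S : Finset (ZMod n)}
    (hS : AvoidsDiff d S) :
    (Finset.univ.filter fun z => z ∉ S ∧ z + d ∉ S ∧ z - d ∉ S).card + 3 * S.card =
      n + (S.filter fun x => x + 2 * d ∈ S).card := by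
  set U := S.map (addRightEmbedding d) with hU
  set W := S.map (addRightEmbedding (-d)) with hW
  have memU : ∀ z, z ∈ U ↔ z - d ∈ S := by
    intro z
    simp only [hU, Finset.mem_map, addRightEmbedding_apply]
    exact ⟨by rintro ⟨x, hx, rfl⟩; simpa using hx, fun h => ⟨_, h, by ring⟩⟩
  have memW : ∀ z, z ∈ W ↔ z + d ∈ S := by
    intro z
    simp only [hW, Finset.mem_map, addRightEmbedding_apply]
    exact ⟨by rintro ⟨x, hx, rfl⟩; simpa using hx, fun h => ⟨_, h, by ring⟩⟩
  have h1 : (Finset.univ.filter fun z => z ∉ S ∧ z + d ∉ S ∧ z - d ∉ S) = (S ∪ (U ∪ W))ᶜ := by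
    ext z
    simp only [Finset.mem_filter, Finset.mem_univ, true_and, Finset.mem_compl, Finset.mem_union,
      memU, memW]
    tauto
  have h2 : Disjoint S (U ∪ W) := by
    rw [Finset.disjoint_left]
    intro x hx hx'
    rw [Finset.mem_union, memU, memW] at hx'
    rcases hx' with h | h
    · exact hS _ h (by simpa using hx)
    · exact hS x hx h
  have h3 : (S.filter fun x => x + 2 * d ∈ S).card = (U ∩ W).card := by
    refine Finset.card_nbij' (fun x => x + d) (fun x => x - d) ?_ ?_ ?_ ?_
    · intro x hx
      simp only [Finset.coe_filter, Set.mem_ofPred_eq, Finset.mem_coe, Finset.mem_inter, memU,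
        memW, add_sub_cancel_right] at hx ⊢
      exact ⟨hx.1, by rw [show x + d + d = x + 2 * d by ring]; exact hx.2⟩
    · intro x hx
      simp only [Finset.coe_filter, Set.mem_ofPred_eq, Finset.mem_coe, Finset.mem_inter, memU,
        memW] at hx ⊢
      exact ⟨hx.1, by rw [show x - d + 2 * d = x + d by ring]; exact hx.2⟩
    · intro x _
      simp
    · intro x _
      simp
  have h4 : U.card = S.card := Finset.card_map _
  have h5 : W.card = S.card := Finset.card_map _
  have h6 := Finset.card_union_add_card_inter U W
  have h7 := Finset.card_union_of_disjoint h2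
  have h8 := Finset.card_le_univ (S ∪ (U ∪ W))
  rw [h1, Finset.card_compl]
  rw [ZMod.card] at *
  omega

/-- The number of `k`-element sets without difference `d` that contain `x` and `x + 2 * d`. -/
noncomputable def pairAvoidCount {n : ℕ} [NeZero n] (d : ZMod n) (k : ℕ) (x : ZMod n) : ℕ :=
  (cardFamily k fun S => AvoidsDiff d S ∧ x ∈ S ∧ x + 2 * d ∈ S).card

theorem avoidCount_zero {n : ℕ} [NeZero n] (d : ZMod n) : avoidCount d 0 = 1 :=
  card_cardFamily_zero (by simp [AvoidsDiff])

/-- Sum `card_extensions` over all `k`-sets. Dependence on `d` enters the recurrence only through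
the pairs at distance `2 * d`. -/
theorem avoidCount_succ {n : ℕ} [NeZero n] {d : ZMod n} (hd : d ≠ 0) (k : ℕ) :
    (k + 1) * avoidCount d (k + 1) + 3 * k * avoidCount d k =
      n * avoidCount d k + ∑ x, pairAvoidCount d k x := by
  classical
  have h1 : ∑ x, pairAvoidCount d k x =
      ∑ S ∈ cardFamily k (AvoidsDiff d), (S.filter fun x => x + 2 * d ∈ S).card := by
    have := Finset.sum_card_bipartiteAbove_eq_sum_card_bipartiteBelow
      (s := cardFamily k (AvoidsDiff d)) (t := (Finset.univ : Finset (ZMod n)))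
      (fun S x => x ∈ S ∧ x + 2 * d ∈ S)
    simp only [Finset.bipartiteAbove, Finset.bipartiteBelow] at this
    refine Eq.trans ?_ (this.symm.trans ?_)
    · refine Finset.sum_congr rfl fun x _ => congrArg Finset.card ?_
      ext S
      simp [and_assoc]
    · refine Finset.sum_congr rfl fun S _ => congrArg Finset.card ?_
      ext x
      simp
  have h2 : 3 * k * avoidCount d k = ∑ S ∈ cardFamily k (AvoidsDiff d), 3 * S.card := by
    rw [Finset.sum_congr rfl fun S hS => by rw [(mem_cardFamily.1 hS).1], Finset.sum_const,
      smul_eq_mul, mul_comm, avoidCount]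
  have h3 : n * avoidCount d k = ∑ S ∈ cardFamily k (AvoidsDiff d), n := by
    rw [Finset.sum_const, smul_eq_mul, mul_comm, avoidCount]
  rw [h1, h2, h3, avoidCount, succ_mul_card_cardFamily AvoidsDiff.mono, ← Finset.sum_add_distrib,
    ← Finset.sum_add_distrib]
  refine Finset.sum_congr rfl fun S hS => ?_
  have hS' := (mem_cardFamily.1 hS).2
  rw [← card_extensions hS']
  simp only [avoidsDiff_insert hd hS']

theorem avoidCount_one {n : ℕ} [NeZero n] {d : ZMod n} (hd : d ≠ 0) : avoidCount d 1 = n := by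
  have h := avoidCount_succ hd 0
  have h0 : ∑ x, pairAvoidCount d 0 x = 0 := by
    refine Finset.sum_eq_zero fun x _ => ?_
    rw [pairAvoidCount, Finset.card_eq_zero, Finset.eq_empty_iff_forall_notMem]
    intro S hS
    rw [mem_cardFamily, Finset.card_eq_zero] at hS
    simp [hS.1] at hS
  rw [h0, avoidCount_zero] at h
  simpa using h

theorem two_mul_avoidCount_two {n : ℕ} [NeZero n] {d : ZMod n} (hd : d ≠ 0) (hd2 : 2 * d ≠ 0) :
    2 * avoidCount d 2 + 3 * n = n * n := by
  have h := avoidCount_succ hd 1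
  have h0 : ∑ x, pairAvoidCount d 1 x = 0 := by
    refine Finset.sum_eq_zero fun x _ => ?_
    rw [pairAvoidCount, Finset.card_eq_zero, Finset.eq_empty_iff_forall_notMem]
    intro S hS
    rw [mem_cardFamily, Finset.card_eq_one] at hS
    obtain ⟨⟨y, rfl⟩, -, h1, h2⟩ := hS
    rw [Finset.mem_singleton] at h1 h2
    exact hd2 (by linear_combination h2 - h1)
  rw [h0, avoidCount_one hd] at h
  simpa using h

/-- Extending `{x, x + 2 * d}`: the sets `J` disjoint from it whose union with it has no two
elements of difference `d`. -/
def PairExtension {n : ℕ} (d x : ZMod n) (J : Finset (ZMod n)) : Prop :=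
  AvoidsDiff d J ∧ ∀ z ∈ J, z ≠ x - d ∧ z ≠ x ∧ z ≠ x + d ∧ z ≠ x + 2 * d ∧ z ≠ x + 3 * d

theorem PairExtension.mono {n : ℕ} {d x : ZMod n} (S T : Finset (ZMod n)) (hST : S ⊆ T)
    (hT : PairExtension d x T) : PairExtension d x S :=
  ⟨AvoidsDiff.mono S T hST hT.1, fun z hz => hT.2 z (hST hz)⟩

/-- Delete the pair `x`, `x + 2 * d`; what remains must avoid the five-term progression formed by
the pair and its neighbours. -/
theorem pairAvoidCount_add_two {n : ℕ} [NeZero n] {d : ZMod n} (hd : d ≠ 0) (hd2 : 2 * d ≠ 0)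
    (hd3 : 3 * d ≠ 0) (k : ℕ) (x : ZMod n) :
    pairAvoidCount d (k + 2) x = (cardFamily k (PairExtension d x)).card := by
  classical
  have hne : x ≠ x + 2 * d := fun h => hd2 (by linear_combination -h)
  refine Finset.card_nbij' (fun S => (S.erase x).erase (x + 2 * d))
    (fun J => insert (x + 2 * d) (insert x J)) ?_ ?_ ?_ ?_
  · intro S hS
    simp only [Finset.mem_coe, mem_cardFamily] at hS ⊢
    obtain ⟨hk, hav, hx, hx2⟩ := hS
    have hx2' : x + 2 * d ∈ S.erase x := Finset.mem_erase.2 ⟨hne.symm, hx2⟩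
    refine ⟨?_, AvoidsDiff.mono _ _ ((Finset.erase_subset _ _).trans (Finset.erase_subset _ _)) hav,
      fun z hz => ?_⟩
    · rw [Finset.card_erase_of_mem hx2', Finset.card_erase_of_mem hx, hk]
      omega
    · rw [Finset.mem_erase, Finset.mem_erase] at hz
      obtain ⟨h1, h2, h3⟩ := hz
      refine ⟨?_, h2, ?_, h1, ?_⟩
      · rintro rfl
        exact hav _ h3 (by simpa using hx)
      · rintro rfl
        exact hav _ hx h3
      · rintro rfl
        exact hav _ hx2 (by rwa [show x + 2 * d + d = x + 3 * d by ring])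
  · intro J hJ
    simp only [Finset.mem_coe, mem_cardFamily] at hJ ⊢
    obtain ⟨hk, hav, hJ⟩ := hJ
    have hx : x ∉ J := fun h => (hJ x h).2.1 rfl
    have hx2 : x + 2 * d ∉ J := fun h => (hJ _ h).2.2.2.1 rfl
    have h1 : AvoidsDiff d (insert x J) := by
      rw [avoidsDiff_insert hd hav]
      exact ⟨fun h => (hJ _ h).2.2.1 rfl, fun h => (hJ _ h).1 rfl⟩
    refine ⟨?_, ?_, by simp, by simp⟩
    · rw [Finset.card_insert_of_notMem (by simp [hx2, hd2]), Finset.card_insert_of_notMem hx, hk]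
    · rw [avoidsDiff_insert hd h1]
      simp only [Finset.mem_insert, not_or]
      refine ⟨⟨fun h => hd3 (by linear_combination h), fun h => (hJ _ h).2.2.2.2 (by ring)⟩,
        ⟨fun h => hd (by linear_combination h), fun h => (hJ _ h).2.2.1 (by ring)⟩⟩
  · intro S hS
    simp only [Finset.mem_coe, mem_cardFamily] at hS
    obtain ⟨hk, hav, hx, hx2⟩ := hS
    ext z
    simp only [Finset.mem_insert, Finset.mem_erase]
    constructor
    · rintro (rfl | rfl | h)
      · exact hx2
      · exact hx
      · exact h.2.2
    · tauto
  · intro J hJ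
    simp only [Finset.mem_coe, mem_cardFamily] at hJ
    obtain ⟨hk, hav, hJ⟩ := hJ
    ext z
    simp only [Finset.mem_insert, Finset.mem_erase]
    constructor
    · tauto
    · intro h
      have := hJ z h
      tauto

theorem pairExtension_singleton {n : ℕ} {d x z : ZMod n} (hd : d ≠ 0) :
    PairExtension d x {z} ↔ z ∉ ({x - d, x, x + d, x + 2 * d, x + 3 * d} : Finset (ZMod n)) := by
  simp [PairExtension, AvoidsDiff, hd]

theorem cardFamily_one_pairExtension {n : ℕ} [NeZero n] {d : ZMod n} (hd : d ≠ 0) (x : ZMod n) :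
    cardFamily 1 (PairExtension d x) =
      ({x - d, x, x + d, x + 2 * d, x + 3 * d} : Finset (ZMod n))ᶜ.map
        ⟨fun z => {z}, Finset.singleton_injective⟩ := by
  ext J
  rw [mem_cardFamily, Finset.card_eq_one]
  simp only [Finset.mem_map, Finset.mem_compl, Function.Embedding.coeFn_mk]
  constructor
  · rintro ⟨⟨z, rfl⟩, hz⟩
    exact ⟨z, (pairExtension_singleton hd).1 hz, rfl⟩
  · rintro ⟨z, hz, rfl⟩
    exact ⟨⟨z, rfl⟩, (pairExtension_singleton hd).2 hz⟩

theorem card_five_progression {n : ℕ} {d : ZMod n} (hd : d ≠ 0) (hd2 : 2 * d ≠ 0)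
    (hd3 : 3 * d ≠ 0) (hd4 : 4 * d ≠ 0) (x : ZMod n) :
    ({x - d, x, x + d, x + 2 * d, x + 3 * d} : Finset (ZMod n)).card = 5 := by
  have h : ([x - d, x, x + d, x + 2 * d, x + 3 * d] : List (ZMod n)).Nodup := by
    simp only [List.nodup_cons, List.mem_cons, List.not_mem_nil, or_false, not_or, List.nodup_nil,
      not_false_eq_true, and_true]
    refine ⟨⟨?_, ?_, ?_, ?_⟩, ⟨?_, ?_, ?_⟩, ⟨?_, ?_⟩, ?_⟩ <;> intro h
    all_goals
      first
      | exact hd (by linear_combination -h)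
      | exact hd2 (by linear_combination -h)
      | exact hd3 (by linear_combination -h)
      | exact hd4 (by linear_combination -h)
  simpa using List.toFinset_card_of_nodup h

theorem card_pairExtension_one {n : ℕ} [NeZero n] {d : ZMod n} (hd : d ≠ 0) (hd2 : 2 * d ≠ 0)
    (hd3 : 3 * d ≠ 0) (hd4 : 4 * d ≠ 0) (x : ZMod n) :
    (cardFamily 1 (PairExtension d x)).card = n - 5 := by
  rw [cardFamily_one_pairExtension hd, Finset.card_map, Finset.card_compl, ZMod.card,
    card_five_progression hd hd2 hd3 hd4]

/-- Choose two points outside the five-term progression `B`, not differing by `d`. The slack of 2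
covers order five, where `B` is closed under adding `d`; otherwise one outside point on each side
has a neighbour in `B`. -/
theorem card_pairExtension_two {n : ℕ} [NeZero n] {d : ZMod n} (hn : 8 ≤ n) (hd : d ≠ 0)
    (hd2 : 2 * d ≠ 0) (hd3 : 3 * d ≠ 0) (hd4 : 4 * d ≠ 0) (x : ZMod n) :
    (n - 5) * (n - 8) ≤ 2 * (cardFamily 2 (PairExtension d x)).card ∧
      2 * (cardFamily 2 (PairExtension d x)).card ≤ (n - 5) * (n - 8) + 2 := by
  classical
  set B : Finset (ZMod n) := {x - d, x, x + d, x + 2 * d, x + 3 * d} with hB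
  have hBc : Bᶜ.card = n - 5 := by
    rw [Finset.card_compl, ZMod.card, card_five_progression hd hd2 hd3 hd4]
  -- Given the first point `z`, the second must avoid `z` and those of `z + d`, `z - d` that are not
  -- already excluded by `B`.
  have hloc : ∀ z ∈ Bᶜ, (Finset.univ.filter fun w => w ∉ ({z} : Finset (ZMod n)) ∧
      PairExtension d x (insert w {z})).card + (1 + (if z + d ∈ Bᶜ then 1 else 0) +
        (if z - d ∈ Bᶜ then 1 else 0)) = n - 5 := by
    intro z hz
    have h1 : (Finset.univ.filter fun w => w ∉ ({z} : Finset (ZMod n)) ∧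
        PairExtension d x (insert w {z})) = Bᶜ \ {z, z + d, z - d} := by
      ext w
      have hav : AvoidsDiff d {z} := by simp [AvoidsDiff, hd]
      have hz' : PairExtension d x {z} := (pairExtension_singleton hd).2 (Finset.mem_compl.1 hz)
      have key : PairExtension d x (insert w {z}) ↔
          (w + d ≠ z ∧ w - d ≠ z) ∧ w ∈ Bᶜ := by
        rw [PairExtension, avoidsDiff_insert hd hav, Finset.mem_singleton, Finset.mem_singleton]
        refine and_congr_right fun _ => ?_
        rw [Finset.mem_compl, ← pairExtension_singleton hd]
        constructor
        · intro h
          refine ⟨by simp [AvoidsDiff, hd], fun y hy => h y ?_⟩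
          rw [Finset.mem_singleton] at hy
          simp [hy]
        · intro h y hy
          rw [Finset.mem_insert] at hy
          rcases hy with rfl | hy
          · exact h.2 _ (Finset.mem_singleton_self _)
          · exact hz'.2 y hy
      simp only [Finset.mem_filter, Finset.mem_univ, true_and, key, Finset.mem_sdiff,
        Finset.mem_insert, Finset.mem_singleton, not_or]
      constructor
      · rintro ⟨h1, ⟨h2, h3⟩, h4⟩
        exact ⟨h4, h1, fun h => h3 (by rw [h]; ring), fun h => h2 (by rw [h]; ring)⟩
      · rintro ⟨h4, h1, h2, h3⟩
        exact ⟨h1, ⟨fun h => h3 (by rw [← h]; ring), fun h => h2 (by rw [← h]; ring)⟩, h4⟩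
    have h2 : (({z, z + d, z - d} : Finset (ZMod n)) ∩ Bᶜ).card =
        1 + (if z + d ∈ Bᶜ then 1 else 0) + (if z - d ∈ Bᶜ then 1 else 0) := by
      rw [← Finset.filter_mem_eq_inter, Finset.card_filter, Finset.sum_insert, Finset.sum_insert,
        Finset.sum_singleton, if_pos hz, add_assoc]
      · rw [Finset.mem_singleton]
        exact fun h => hd2 (by linear_combination h)
      · rw [Finset.mem_insert, Finset.mem_singleton, not_or]
        exact ⟨fun h => hd (by linear_combination -h), fun h => hd (by linear_combination h)⟩
    rw [h1, ← h2, ← hBc]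
    have := Finset.card_sdiff_add_card_inter Bᶜ {z, z + d, z - d}
    rwa [Finset.inter_comm] at this
  have hsum := succ_mul_card_cardFamily (PairExtension.mono (d := d) (x := x)) 1
  rw [cardFamily_one_pairExtension hd, ← hB, Finset.sum_map] at hsum
  simp only [Function.Embedding.coeFn_mk] at hsum
  have htot := Finset.sum_congr (Eq.refl (Bᶜ)) hloc
  rw [Finset.sum_add_distrib, Finset.sum_add_distrib, Finset.sum_add_distrib, ← hsum,
    Finset.sum_const, Finset.sum_const, hBc, ← Finset.card_filter, ← Finset.card_filter,
    smul_eq_mul, smul_eq_mul] at htot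
  have hup : ∀ e : ZMod n, (Bᶜ.filter fun z => z + e ∈ Bᶜ).card ≤ n - 5 :=
    fun e => (Finset.card_filter_le _ _).trans hBc.le
  -- At most one point outside `B`, namely the `y` adjoining its end, is moved into `B`.
  have hlow : ∀ (f : ZMod n → ZMod n) (y : ZMod n), (∀ z, f z ∈ B → z = y ∨ z ∈ B) →
      n - 6 ≤ (Bᶜ.filter fun z => f z ∈ Bᶜ).card := by
    intro f y hy
    have hsub : (insert y B)ᶜ ⊆ Bᶜ.filter fun z => f z ∈ Bᶜ := by
      intro z hz
      rw [Finset.mem_compl, Finset.mem_insert, not_or] at hz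
      rw [Finset.mem_filter, Finset.mem_compl, Finset.mem_compl]
      exact ⟨hz.2, fun h => (hy z h).elim hz.1 hz.2⟩
    have h1 := Finset.card_le_card hsub
    have h2 := Finset.card_insert_le y B
    rw [Finset.card_compl, ZMod.card] at h1
    rw [Finset.card_compl, ZMod.card] at hBc
    have h3 := card_five_progression hd hd2 hd3 hd4 x
    rw [← hB] at h3
    omega
  have hu1 := hup d
  have hu2 : (Bᶜ.filter fun z => z - d ∈ Bᶜ).card ≤ n - 5 :=
    (Finset.card_filter_le _ _).trans hBc.le
  have hl1 := hlow (fun z => z + d) (x - 2 * d) (by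
    intro z hz
    simp only [hB, Finset.mem_insert, Finset.mem_singleton] at hz ⊢
    rcases hz with h | h | h | h | h
    · exact .inl (by linear_combination h)
    · exact .inr (.inl (by linear_combination h))
    · exact .inr (.inr (.inl (by linear_combination h)))
    · exact .inr (.inr (.inr (.inl (by linear_combination h))))
    · exact .inr (.inr (.inr (.inr (.inl (by linear_combination h))))))
  have hl2 := hlow (fun z => z - d) (x + 4 * d) (by
    intro z hz
    simp only [hB, Finset.mem_insert, Finset.mem_singleton] at hz ⊢
    rcases hz with h | h | h | h | h
    · exact .inr (.inr (.inl (by linear_combination h)))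
    · exact .inr (.inr (.inr (.inl (by linear_combination h))))
    · exact .inr (.inr (.inr (.inr (.inl (by linear_combination h)))))
    · exact .inr (.inr (.inr (.inr (.inr (by linear_combination h)))))
    · exact .inl (by linear_combination h))
  obtain ⟨m, rfl⟩ : ∃ m, n = m + 8 := ⟨n - 8, by omega⟩
  have e1 : m + 8 - 5 = m + 3 := by omega
  have e2 : m + 8 - 8 = m := by omega
  have e3 : m + 8 - 6 = m + 2 := by omega
  rw [e1] at htot hu1 hu2
  rw [e3] at hl1 hl2
  rw [e1, e2]
  constructor <;> nlinarith

/-- The numbers of sets without difference `d`, for `d` of order at least five. -/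
theorem avoidCount_recurrences {n : ℕ} [NeZero n] {d : ZMod n} (hn : 8 ≤ n) (hd : d ≠ 0)
    (hd2 : 2 * d ≠ 0) (hd3 : 3 * d ≠ 0) (hd4 : 4 * d ≠ 0) :
    3 * avoidCount d 3 + 6 * avoidCount d 2 = n * avoidCount d 2 + n ∧
    4 * avoidCount d 4 + 9 * avoidCount d 3 = n * avoidCount d 3 + n * (n - 5) ∧
    ∃ s, 5 * avoidCount d 5 + 12 * avoidCount d 4 = n * avoidCount d 4 + s ∧
      n * ((n - 5) * (n - 8)) ≤ 2 * s ∧ 2 * s ≤ n * ((n - 5) * (n - 8) + 2) := by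
  have r2 := avoidCount_succ hd 2
  have r3 := avoidCount_succ hd 3
  have r4 := avoidCount_succ hd 4
  have p2 : ∑ x, pairAvoidCount d 2 x = n := by
    rw [Finset.sum_congr rfl fun x _ => (pairAvoidCount_add_two hd hd2 hd3 0 x).trans
      (card_cardFamily_zero (by simp [PairExtension, AvoidsDiff]))]
    simp [ZMod.card]
  have p3 : ∑ x, pairAvoidCount d 3 x = n * (n - 5) := by
    rw [Finset.sum_congr rfl fun x _ => (pairAvoidCount_add_two hd hd2 hd3 1 x).trans
      (card_pairExtension_one hd hd2 hd3 hd4 x)]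
    simp [ZMod.card]
  refine ⟨by rw [p2] at r2; linarith, by rw [p3] at r3; linarith,
    ∑ x, pairAvoidCount d 4 x, by linarith, ?_, ?_⟩
  · rw [Finset.mul_sum]
    have := Finset.sum_le_sum fun (x : ZMod n) (_ : x ∈ Finset.univ) =>
      (card_pairExtension_two hn hd hd2 hd3 hd4 x).1
    simp only [Finset.sum_const, Finset.card_univ, ZMod.card, smul_eq_mul] at this
    refine this.trans (Finset.sum_le_sum fun x _ => ?_)
    rw [pairAvoidCount_add_two hd hd2 hd3 2 x]
  · rw [Finset.mul_sum]
    have := Finset.sum_le_sum fun (x : ZMod n) (_ : x ∈ Finset.univ) =>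
      (card_pairExtension_two hn hd hd2 hd3 hd4 x).2
    simp only [Finset.sum_const, Finset.card_univ, ZMod.card, smul_eq_mul] at this
    refine (Finset.sum_le_sum fun x _ => ?_).trans this
    rw [pairAvoidCount_add_two hd hd2 hd3 2 x]

/-- For order three, `x + 2 * d` and `x` themselves differ by `d`, so the pair term vanishes, where
longer cycles contribute `n`. -/
theorem avoidCount_three_of_three_mul_eq_zero {n : ℕ} [NeZero n] {d : ZMod n} (hd : d ≠ 0)
    (hd3 : 3 * d = 0) : 3 * avoidCount d 3 + 6 * avoidCount d 2 = n * avoidCount d 2 := by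
  have r2 := avoidCount_succ hd 2
  have p2 : ∑ x, pairAvoidCount d 2 x = 0 := by
    refine Finset.sum_eq_zero fun x _ => ?_
    rw [pairAvoidCount, Finset.card_eq_zero, Finset.eq_empty_iff_forall_notMem]
    intro S hS
    obtain ⟨-, hav, hx, hx2⟩ := mem_cardFamily.1 hS
    exact hav _ hx2 (by rwa [show x + 2 * d + d = x by linear_combination hd3])
  rw [p2] at r2
  linarith

/-- Comparison of the numbers of sets avoiding two differences of order at least five. -/
theorem avoidCount_comparison {n : ℕ} [NeZero n] {d e : ZMod n} (hn : 12 ≤ n)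
    (hd : d ≠ 0) (hd2 : 2 * d ≠ 0) (hd3 : 3 * d ≠ 0) (hd4 : 4 * d ≠ 0)
    (he : e ≠ 0) (he2 : 2 * e ≠ 0) (he3 : 3 * e ≠ 0) (he4 : 4 * e ≠ 0) :
    (∀ k ≤ 4, avoidCount d k = avoidCount e k) ∧
      5 * avoidCount d 5 ≤ 5 * avoidCount e 5 + n := by
  have d2 := two_mul_avoidCount_two hd hd2
  have e2 := two_mul_avoidCount_two he he2
  obtain ⟨d3, d4, s, d5, -, ds⟩ := avoidCount_recurrences (by omega) hd hd2 hd3 hd4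
  obtain ⟨e3, e4, t, e5, et, -⟩ := avoidCount_recurrences (by omega) he he2 he3 he4
  have h2 : avoidCount d 2 = avoidCount e 2 := by omega
  have h3 : avoidCount d 3 = avoidCount e 3 := by
    rw [h2] at d3
    omega
  have h4 : avoidCount d 4 = avoidCount e 4 := by
    rw [h3] at d4
    omega
  refine ⟨fun k hk => ?_, ?_⟩
  · interval_cases k
    · rw [avoidCount_zero, avoidCount_zero]
    · rw [avoidCount_one hd, avoidCount_one he]
    · exact h2
    · exact h3
    · exact h4
  · rw [h4] at d5
    rw [mul_add] at ds
    omega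

/-! ### Closed sets and blocks: upper bounds. -/

/-- The number of closed `k`-element sets. -/
noncomputable def closedCount {n : ℕ} [NeZero n] (a b : ZMod n) (k : ℕ) : ℕ :=
  (cardFamily k (IsCutClosed a b)).card

theorem strongCutCount_eq_card_cardFamily {V : Type*} [Fintype V] [DecidableEq V] (G : Digraph V)
    (k : ℕ) : strongCutCount G k = (cardFamily k fun S : Finset V =>
      IsStronglyConnected (inducedSubdigraph G Sᶜ)).card := by
  rw [strongCutCount]
  congr 1
  ext S
  simp only [Finset.mem_filter, Finset.mem_univ, true_and, mem_cardFamily]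
  convert Iff.rfl

theorem strongCutCount_le_closedCount {n : ℕ} [NeZero n] (a b : ZMod n) {k : ℕ}
    (hk : k + 2 ≤ n) : strongCutCount (circulant n {a, b}) k ≤ closedCount a b k := by
  rw [strongCutCount_eq_card_cardFamily]
  refine Finset.card_le_card fun S hS => ?_
  rw [mem_cardFamily] at hS ⊢
  exact ⟨hS.1, isCutClosed_of_isStronglyConnected (by omega) hS.2⟩

/-- The four vertices that a closed set containing `x` and `x + (b - a)` has to contain. -/
def block {n : ℕ} (a b x : ZMod n) : Finset (ZMod n) :=
  {x, x + (b - a), x - a, x + b}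

theorem mem_block {n : ℕ} {a b x y : ZMod n} :
    y ∈ block a b x ↔ y = x ∨ y = x + (b - a) ∨ y = x - a ∨ y = x + b := by
  simp [block]

theorem IsCutClosed.block_subset {n : ℕ} {a b : ZMod n} {S : Finset (ZMod n)}
    (hS : IsCutClosed a b S) {x : ZMod n} (hx : x ∈ S) (hxd : x + (b - a) ∈ S) :
    block a b x ⊆ S := by
  intro y hy
  rcases mem_block.1 hy with rfl | rfl | rfl | rfl
  · exact hx
  · exact hxd
  · exact (hS x hx hxd).1
  · exact (hS x hx hxd).2

theorem card_block {n : ℕ} {a b : ZMod n} (ha : a ≠ 0) (hb : b ≠ 0) (hab : a ≠ b)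
    (hs : a + b ≠ 0) (x : ZMod n) : (block a b x).card = 4 := by
  have h : ([x, x + (b - a), x - a, x + b] : List (ZMod n)).Nodup := by
    simp only [List.nodup_cons, List.mem_cons, List.not_mem_nil, or_false, not_or, List.nodup_nil,
      not_false_eq_true, and_true]
    refine ⟨⟨?_, ?_, ?_⟩, ⟨?_, ?_⟩, ?_⟩ <;> grind
  simpa [block] using List.toFinset_card_of_nodup h

/-- Three forced vertices are already distinct without `a + b ≠ 0`, which is what the bidirected
cycle needs. -/
theorem IsCutClosed.avoidsDiff_of_card_le_two {n : ℕ} {a b : ZMod n} (ha : a ≠ 0) (hb : b ≠ 0)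
    (hab : a ≠ b) {S : Finset (ZMod n)} (hS : IsCutClosed a b S) (hcard : S.card ≤ 2) :
    AvoidsDiff (b - a) S := by
  intro x hx hxd
  have h : ([x, x + (b - a), x - a] : List (ZMod n)).Nodup := by
    simp only [List.nodup_cons, List.mem_cons, List.not_mem_nil, or_false, not_or, List.nodup_nil,
      not_false_eq_true, and_true]
    refine ⟨⟨?_, ?_⟩, ?_⟩ <;> grind
  have h1 := List.toFinset_card_of_nodup h
  have h2 : [x, x + (b - a), x - a].toFinset ⊆ S := by
    intro y hy
    simp only [List.toFinset_cons, List.toFinset_nil, insert_empty_eq, Finset.mem_insert,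
      Finset.mem_singleton] at hy
    rcases hy with rfl | rfl | rfl
    · exact hx
    · exact hxd
    · exact (hS x hx hxd).1
  have h3 := Finset.card_le_card h2
  simp at h1
  simp at h3
  omega

theorem IsCutClosed.avoidsDiff_of_card_le_three {n : ℕ} {a b : ZMod n} (ha : a ≠ 0) (hb : b ≠ 0)
    (hab : a ≠ b) (hs : a + b ≠ 0) {S : Finset (ZMod n)} (hS : IsCutClosed a b S)
    (hcard : S.card ≤ 3) : AvoidsDiff (b - a) S := by
  intro x hx hxd
  have h1 := Finset.card_le_card (hS.block_subset hx hxd)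
  rw [card_block ha hb hab hs] at h1
  omega

theorem closedCount_le_avoidCount_of_le_two {n : ℕ} [NeZero n] {a b : ZMod n} (ha : a ≠ 0)
    (hb : b ≠ 0) (hab : a ≠ b) {k : ℕ} (hk : k ≤ 2) :
    closedCount a b k ≤ avoidCount (b - a) k := by
  refine Finset.card_le_card fun S hS => ?_
  rw [mem_cardFamily] at hS ⊢
  exact ⟨hS.1, hS.2.avoidsDiff_of_card_le_two ha hb hab (by omega)⟩

theorem closedCount_le_avoidCount_of_le_three {n : ℕ} [NeZero n] {a b : ZMod n} (ha : a ≠ 0)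
    (hb : b ≠ 0) (hab : a ≠ b) (hs : a + b ≠ 0) {k : ℕ} (hk : k ≤ 3) :
    closedCount a b k ≤ avoidCount (b - a) k := by
  refine Finset.card_le_card fun S hS => ?_
  rw [mem_cardFamily] at hS ⊢
  exact ⟨hS.1, hS.2.avoidsDiff_of_card_le_three ha hb hab hs (by omega)⟩

/-- A closed four-element set with a forcing pair equals its block, and there are at most `n`
blocks. -/
theorem closedCount_four_le {n : ℕ} [NeZero n] {a b : ZMod n} (ha : a ≠ 0) (hb : b ≠ 0)
    (hab : a ≠ b) (hs : a + b ≠ 0) : closedCount a b 4 ≤ avoidCount (b - a) 4 + n := by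
  classical
  have hsub : cardFamily 4 (IsCutClosed a b) ⊆
      cardFamily 4 (AvoidsDiff (b - a)) ∪ Finset.univ.image (block a b) := by
    intro S hS
    rw [mem_cardFamily] at hS
    rw [Finset.mem_union, mem_cardFamily]
    by_cases hav : AvoidsDiff (b - a) S
    · exact .inl ⟨hS.1, hav⟩
    · right
      simp only [AvoidsDiff, not_forall, not_not] at hav
      obtain ⟨x, hx, hxd⟩ := hav
      refine Finset.mem_image.2 ⟨x, Finset.mem_univ _, ?_⟩
      exact Finset.eq_of_subset_of_card_le (hS.2.block_subset hx hxd)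
        (by rw [hS.1, card_block ha hb hab hs])
  refine (Finset.card_le_card hsub).trans ((Finset.card_union_le _ _).trans ?_)
  refine Nat.add_le_add_left (Finset.card_image_le.trans ?_) _
  rw [Finset.card_univ, ZMod.card]

/-- A bound for the number of closed five-element sets, in terms of a set `F` of displacements
that cannot be added to a block. -/
theorem closedCount_five_le {n : ℕ} [NeZero n] {a b : ZMod n} (F : Finset (ZMod n))
    (hF : 9 ≤ F.card)
    (h : ∀ S, IsCutClosed a b S → S.card = 5 → ¬ AvoidsDiff (b - a) S →
      ∃ x z, z ∉ F ∧ S = insert (x + z) (block a b x)) :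
    closedCount a b 5 ≤ avoidCount (b - a) 5 + n * (n - 9) := by
  classical
  have hsub : cardFamily 5 (IsCutClosed a b) ⊆ cardFamily 5 (AvoidsDiff (b - a)) ∪
      (Finset.univ ×ˢ Fᶜ).image fun p => insert (p.1 + p.2) (block a b p.1) := by
    intro S hS
    rw [mem_cardFamily] at hS
    rw [Finset.mem_union, mem_cardFamily]
    by_cases hav : AvoidsDiff (b - a) S
    · exact .inl ⟨hS.1, hav⟩
    · right
      obtain ⟨x, z, hz, rfl⟩ := h S hS.2 hS.1 hav
      exact Finset.mem_image.2 ⟨(x, z), by simpa using hz, rfl⟩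
  refine (Finset.card_le_card hsub).trans ((Finset.card_union_le _ _).trans ?_)
  refine Nat.add_le_add_left (Finset.card_image_le.trans ?_) _
  rw [Finset.card_product, Finset.card_univ, Finset.card_compl, ZMod.card]
  exact Nat.mul_le_mul_left _ (by omega)

theorem IsCutClosed.exists_eq_insert_block {n : ℕ} {a b : ZMod n} (ha : a ≠ 0) (hb : b ≠ 0)
    (hab : a ≠ b) (hs : a + b ≠ 0) {S : Finset (ZMod n)} (hS : IsCutClosed a b S)
    (hcard : S.card = 5) (hav : ¬ AvoidsDiff (b - a) S) :
    ∃ x z, x + z ∉ block a b x ∧ S = insert (x + z) (block a b x) := by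
  simp only [AvoidsDiff, not_forall, not_not] at hav
  obtain ⟨x, hx, hxd⟩ := hav
  obtain ⟨w, hw, hwS⟩ := Finset.exists_eq_insert_iff.2 ⟨hS.block_subset hx hxd,
    by rw [card_block ha hb hab hs, hcard]⟩
  refine ⟨x, w - x, ?_, ?_⟩
  · rwa [add_sub_cancel]
  · rw [add_sub_cancel, hwS]

/-- Closedness of a block with one further vertex, in terms of displacements. -/
theorem IsCutClosed.displacement {n : ℕ} {a b x z : ZMod n}
    (hS : IsCutClosed a b (insert (x + z) (block a b x))) (u : ZMod n)
    (h : u = z ∨ u = 0 ∨ u = b - a ∨ u = -a ∨ u = b)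
    (h' : u + (b - a) = z ∨ u + (b - a) = 0 ∨ u + (b - a) = b - a ∨ u + (b - a) = -a ∨
      u + (b - a) = b) :
    (u - a = z ∨ u - a = 0 ∨ u - a = b - a ∨ u - a = -a ∨ u - a = b) ∧
      (u + b = z ∨ u + b = 0 ∨ u + b = b - a ∨ u + b = -a ∨ u + b = b) := by
  have key : ∀ v, x + v ∈ insert (x + z) (block a b x) ↔
      (v = z ∨ v = 0 ∨ v = b - a ∨ v = -a ∨ v = b) := by
    intro v
    rw [Finset.mem_insert, mem_block, sub_eq_add_neg x a]
    simp
  have := hS (x + u) ((key u).2 h) (by rw [add_assoc]; exact (key _).2 h')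
  rwa [add_sub_assoc, add_assoc, key, key] at this

/-- The block consists of four consecutive multiples of `a`. Its outer pairs force both `-2 * a` and
`3 * a` as displacements, one vertex too many, so no such set exists. -/
theorem closedCount_five_le_of_double {n : ℕ} [NeZero n] (hn : 9 ≤ n) {a : ZMod n}
    (h1 : a ≠ 0) (h2 : 2 * a ≠ 0) (h3 : 3 * a ≠ 0) (h4 : 4 * a ≠ 0) (h5 : 5 * a ≠ 0) :
    closedCount a (2 * a) 5 ≤ avoidCount (2 * a - a) 5 + n * (n - 9) := by
  refine closedCount_five_le Finset.univ (by rwa [Finset.card_univ, ZMod.card]) ?_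
  intro S hS hcard hav
  exfalso
  obtain ⟨x, z, -, rfl⟩ := hS.exists_eq_insert_block h1 h2 (by grind) (by grind) hcard hav
  have k1 := (hS.displacement (-a) (by simp) (.inr (.inl (by ring)))).1
  have k2 := (hS.displacement a (.inr (.inr (.inl (by ring))))
    (.inr (.inr (.inr (.inr (by ring)))))).2
  clear hS hcard hav
  have e1 : z = -2 * a := by grind
  have e2 : z = 3 * a := by grind
  exact h5 (by linear_combination e1 - e2)

/-- The block is again four consecutive multiples of `a`, but the forcing difference is `-3 * a`.
Extending the run at one end is the same as extending the next block at the other end, so the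
displacement `a` can be traded for `-4 * a`. -/
theorem closedCount_five_le_of_neg_double {n : ℕ} [NeZero n] {a : ZMod n}
    (h : ∀ j : ℕ, 0 < j → j ≤ 9 → (j : ZMod n) * a ≠ 0) :
    closedCount a (-2 * a) 5 ≤ avoidCount (-2 * a - a) 5 + n * (n - 9) := by
  have h1 := h 1 (by norm_num) (by norm_num)
  have h2 := h 2 (by norm_num) (by norm_num)
  have h3 := h 3 (by norm_num) (by norm_num)
  have h4 := h 4 (by norm_num) (by norm_num)
  have h5 := h 5 (by norm_num) (by norm_num)
  have h6 := h 6 (by norm_num) (by norm_num)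
  have h7 := h 7 (by norm_num) (by norm_num)
  have h8 := h 8 (by norm_num) (by norm_num)
  have h9 := h 9 (by norm_num) (by norm_num)
  push_cast at h1 h2 h3 h4 h5 h6 h7 h8 h9
  clear h
  have hnd : ([3 * a, 2 * a, a, 0, -a, -2 * a, -3 * a, -5 * a, -6 * a] : List (ZMod n)).Nodup := by
    simp only [List.nodup_cons, List.mem_cons, List.not_mem_nil, or_false, not_or, List.nodup_nil,
      not_false_eq_true, and_true]
    refine ⟨⟨?_, ?_, ?_, ?_, ?_, ?_, ?_, ?_⟩, ⟨?_, ?_, ?_, ?_, ?_, ?_, ?_⟩,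
      ⟨?_, ?_, ?_, ?_, ?_, ?_⟩, ⟨?_, ?_, ?_, ?_, ?_⟩, ⟨?_, ?_, ?_, ?_⟩, ⟨?_, ?_, ?_⟩,
      ⟨?_, ?_⟩, ?_⟩ <;> grind
  refine closedCount_five_le
    [3 * a, 2 * a, a, 0, -a, -2 * a, -3 * a, -5 * a, -6 * a].toFinset
    (List.toFinset_card_of_nodup hnd).ge ?_
  clear hnd
  intro S hS hcard hav
  obtain ⟨x, z, hz, rfl⟩ :=
    hS.exists_eq_insert_block (by grind) (by grind) (by grind) (by grind) hcard hav
  by_cases hza : z = a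
  · refine ⟨x + a, -4 * a, ?_, ?_⟩
    · simp only [List.mem_toFinset, List.mem_cons, List.not_mem_nil, or_false, not_or]
      grind
    · ext y
      simp only [Finset.mem_insert, mem_block]
      grind
  · refine ⟨x, z, ?_, rfl⟩
    simp only [List.mem_toFinset, List.mem_cons, List.not_mem_nil, or_false]
    rw [mem_block] at hz
    rintro (hz' | hz' | hz' | hz' | hz' | hz' | hz' | hz' | hz') <;> subst hz'
    · have := (hS.displacement (3 * a) (.inl rfl) (.inr (.inl (by ring)))).1
      clear hS hcard hav
      grind
    · have := (hS.displacement (2 * a) (.inl rfl) (.inr (.inr (.inr (.inl (by ring)))))).1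
      clear hS hcard hav
      grind
    · exact hza rfl
    · grind
    · grind
    · grind
    · grind
    · have := (hS.displacement (-2 * a) (by simp) (.inl (by ring))).2
      clear hS hcard hav
      grind
    · have := (hS.displacement (-3 * a) (.inr (.inr (.inl (by ring)))) (.inl (by ring))).1
      clear hS hcard hav
      grind

theorem nodup_displacements_of_ne {n : ℕ} {a b : ZMod n} (ha : a ≠ 0)
    (hb : b ≠ 0) (hab : b - a ≠ 0) (hs : a + b ≠ 0) (ha2 : 2 * a ≠ 0) (hb2 : 2 * b ≠ 0)
    (hd2 : 2 * (b - a) ≠ 0) (hd3 : 3 * (b - a) ≠ 0)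
    (r1 : b - 2 * a ≠ 0) (r2 : a - 2 * b ≠ 0) 
    (r5 : 3 * a - 2 * b ≠ 0) (r6 : 3 * b - 2 * a ≠ 0) (r7 : b - 3 * a ≠ 0) :
    ([a - b, 0, b - a, 2 * (b - a), -a, b - 2 * a, a, b, 2 * b - a] : List (ZMod n)).Nodup := by
  simp only [List.nodup_cons, List.mem_cons, List.not_mem_nil, or_false, not_or,
    List.nodup_nil, not_false_eq_true, and_true]
  refine ⟨⟨?_, ?_, ?_, ?_, ?_, ?_, ?_, ?_⟩, ⟨?_, ?_, ?_, ?_, ?_, ?_, ?_⟩,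
    ⟨?_, ?_, ?_, ?_, ?_, ?_⟩, ⟨?_, ?_, ?_, ?_, ?_⟩, ⟨?_, ?_, ?_, ?_⟩, ⟨?_, ?_, ?_⟩,
    ⟨?_, ?_⟩, ?_⟩ <;> grind

theorem nodup_displacements_of_ne' {n : ℕ} {a b : ZMod n} (ha : a ≠ 0)
    (hb : b ≠ 0) (hab : b - a ≠ 0) (hs : a + b ≠ 0) (ha2 : 2 * a ≠ 0) (hb2 : 2 * b ≠ 0)
    (hd2 : 2 * (b - a) ≠ 0) (hd3 : 3 * (b - a) ≠ 0)
    (r1 : b - 2 * a ≠ 0) (r2 : a - 2 * b ≠ 0) 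
    (r5 : 3 * a - 2 * b ≠ 0) (r6 : 3 * b - 2 * a ≠ 0) (r7 : a - 3 * b ≠ 0) :
    ([a - b, 0, b - a, 2 * (b - a), -b, -a, b - 2 * a, b, 2 * b - a] : List (ZMod n)).Nodup := by
  simp only [List.nodup_cons, List.mem_cons, List.not_mem_nil, or_false, not_or,
    List.nodup_nil, not_false_eq_true, and_true]
  refine ⟨⟨?_, ?_, ?_, ?_, ?_, ?_, ?_, ?_⟩, ⟨?_, ?_, ?_, ?_, ?_, ?_, ?_⟩,
    ⟨?_, ?_, ?_, ?_, ?_, ?_⟩, ⟨?_, ?_, ?_, ?_, ?_⟩, ⟨?_, ?_, ?_, ?_⟩, ⟨?_, ?_, ?_⟩,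
    ⟨?_, ?_⟩, ?_⟩ <;> grind

/-- The list consists of the block and its translates by `±(b - a)`. A fifth vertex at such a
translate makes a new forcing pair, which would require yet another vertex. -/
theorem IsCutClosed.exists_displacement {n : ℕ} {a b : ZMod n} (ha : a ≠ 0)
    (hb : b ≠ 0) (hab : b - a ≠ 0) (hs : a + b ≠ 0) (ha2 : 2 * a ≠ 0) (hb2 : 2 * b ≠ 0)
    (r1 : b - 2 * a ≠ 0) (r2 : a - 2 * b ≠ 0) (r3 : b + 2 * a ≠ 0)
    (r4 : a + 2 * b ≠ 0) {S : Finset (ZMod n)} (hS : IsCutClosed a b S) (hcard : S.card = 5)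
    (hav : ¬ AvoidsDiff (b - a) S) :
    ∃ x z, z ∉ [a - b, 0, b - a, 2 * (b - a), -b, -a, b - 2 * a, a, b, 2 * b - a] ∧
      S = insert (x + z) (block a b x) := by
  obtain ⟨x, z, hz, rfl⟩ :=
    hS.exists_eq_insert_block ha hb (fun h => hab (by rw [h, sub_self])) hs hcard hav
  refine ⟨x, z, ?_, rfl⟩
  rw [mem_block] at hz
  simp only [List.mem_cons, List.not_mem_nil, or_false]
  clear hcard hav
  rintro (hz' | hz' | hz' | hz' | hz' | hz' | hz' | hz' | hz' | hz') <;> subst hz'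
  · have := (hS.displacement (a - b) (.inl rfl) (.inr (.inl (by ring)))).2
    clear hS
    grind
  · clear hS
    grind
  · clear hS
    grind
  · have := (hS.displacement (b - a) (by simp) (.inl (by ring))).1
    clear hS
    grind
  · have := (hS.displacement (-b) (.inl rfl) (.inr (.inr (.inr (.inl (by ring)))))).1
    clear hS
    grind
  · clear hS
    grind
  · have := (hS.displacement (-a) (by simp) (.inl (by ring))).1
    clear hS
    grind
  · have := (hS.displacement z (.inl rfl) (.inr (.inr (.inr (.inr (by ring)))))).2
    clear hS
    grind
  · clear hS
    grind
  · have := (hS.displacement b (by simp) (.inl (by ring))).2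
    clear hS
    grind

/-- The generic case: no linear relation with small coefficients between `a` and `b`. -/
theorem closedCount_five_le_of_generic {n : ℕ} [NeZero n] {a b : ZMod n} (ha : a ≠ 0)
    (hb : b ≠ 0) (hab : b - a ≠ 0) (hs : a + b ≠ 0) (ha2 : 2 * a ≠ 0) (hb2 : 2 * b ≠ 0)
    (hd2 : 2 * (b - a) ≠ 0) (hd3 : 3 * (b - a) ≠ 0)
    (r1 : b - 2 * a ≠ 0) (r2 : a - 2 * b ≠ 0) (r3 : b + 2 * a ≠ 0)
    (r4 : a + 2 * b ≠ 0) (r5 : 3 * a - 2 * b ≠ 0) (r6 : 3 * b - 2 * a ≠ 0) (ha8 : 8 * a ≠ 0) :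
    closedCount a b 5 ≤ avoidCount (b - a) 5 + n * (n - 9) := by
  -- Nine distinct entries out of ten suffice. Keeping `a` fails only if `b = 3 * a`, keeping `-b`
  -- only if `a = 3 * b`; both together would give `8 * a = 0`. For {2, 3}, by contrast, the
  -- relation `3 * a = 2 * b` makes two coincidences and leaves eight.
  obtain ⟨l, hnd, hl, hsub⟩ : ∃ l : List (ZMod n), l.Nodup ∧ l.length = 9 ∧
      l ⊆ [a - b, 0, b - a, 2 * (b - a), -b, -a, b - 2 * a, a, b, 2 * b - a] := by
    by_cases h3 : a = 3 * b
    · have r7 : b - 3 * a ≠ 0 := fun h => ha8 (by linear_combination -h3 - 3 * h)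
      exact ⟨_, nodup_displacements_of_ne ha hb hab hs ha2 hb2 hd2 hd3 r1 r2 r5 r6 r7, rfl, by simp⟩
    · exact ⟨_, nodup_displacements_of_ne' ha hb hab hs ha2 hb2 hd2 hd3 r1 r2 r5 r6 (sub_ne_zero.2 h3), rfl,
        by simp⟩
  refine closedCount_five_le l.toFinset ?_ fun S h1 h2 h3 => ?_
  · rw [List.toFinset_card_of_nodup hnd, hl]
  · obtain ⟨x, z, hz, hS⟩ := h1.exists_displacement ha hb hab hs ha2 hb2 r1 r2 r3 r4 h2 h3
    exact ⟨x, z, fun h => hz (hsub (List.mem_toFinset.1 h)), hS⟩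

theorem natCast_mul_ne_zero {n : ℕ} {a : ZMod n} (ha : IsUnit a) {j : ℕ} (hj : 0 < j)
    (hjn : j < n) : (j : ZMod n) * a ≠ 0 := by
  intro h
  rw [ha.mul_left_eq_zero, ZMod.natCast_eq_zero_iff] at h
  exact absurd (Nat.le_of_dvd hj h) (by omega)

/-! ### Lower bounds for the connection set {2, 3}. -/

theorem avoidCount_le_closedCount {n : ℕ} [NeZero n] (a b : ZMod n) (k : ℕ) :
    avoidCount (b - a) k ≤ closedCount a b k := by
  refine Finset.card_le_card fun S hS => ?_
  rw [mem_cardFamily] at hS ⊢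
  exact ⟨hS.1, fun x hx hxd => absurd hxd (hS.2 x hx)⟩

/-- The block has displacements -2, 0, 1, 3, whose only consecutive pair is 0, 1. The set excluded
for `z` is the block with its neighbours, so `z` makes no new pair. Hence a set determines its
block. -/
theorem eq_of_mem_insert_block_two_three {n : ℕ}
    (h : ∀ j : ℕ, 0 < j → j ≤ 6 → (j : ZMod n) ≠ 0) {x z y : ZMod n}
    (hz : z ∉ ({-3, -2, -1, 0, 1, 2, 3, 4} : Finset (ZMod n)))
    (hy : y ∈ insert (x + z) (block 2 3 x)) (hy' : y + (3 - 2) ∈ insert (x + z) (block 2 3 x)) :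
    y = x := by
  have h1 := h 1 (by norm_num) (by norm_num)
  have h2 := h 2 (by norm_num) (by norm_num)
  have h3 := h 3 (by norm_num) (by norm_num)
  have h4 := h 4 (by norm_num) (by norm_num)
  have h6 := h 6 (by norm_num) (by norm_num)
  push_cast at h1 h2 h3 h4 h6
  clear h
  obtain ⟨u, rfl⟩ : ∃ u, y = x + u := ⟨y - x, by ring⟩
  rw [Finset.mem_insert, mem_block] at hy hy'
  simp only [Finset.mem_insert, Finset.mem_singleton, not_or] at hz
  obtain ⟨z1, z2, z3, z4, z5, z6, z7, z8⟩ := hz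
  rcases hy with hy | hy | hy | hy | hy
  · have hu : u = z := add_left_cancel hy
    subst hu
    grind
  · exact hy
  · rcases hy' with e | e | e | e | e
    · exact absurd (by linear_combination hy - e) z6
    · exact absurd (by linear_combination e - hy) h2
    · exact absurd (by linear_combination e - hy) h1
    · exact absurd (by linear_combination e - hy) h4
    · exact absurd (by linear_combination hy - e) h1
  · rcases hy' with e | e | e | e | e
    · exact absurd (by linear_combination hy - e) z3
    · exact absurd (by linear_combination hy - e) h1
    · exact absurd (by linear_combination hy - e) h2
    · exact absurd (by linear_combination e - hy) h1
    · exact absurd (by linear_combination hy - e) h4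
  · rcases hy' with e | e | e | e | e
    · exact absurd (by linear_combination hy - e) z8
    · exact absurd (by linear_combination e - hy) h4
    · exact absurd (by linear_combination e - hy) h3
    · exact absurd (by linear_combination e - hy) h6
    · exact absurd (by linear_combination e - hy) h1

theorem isCutClosed_insert_block_two_three {n : ℕ}
    (h : ∀ j : ℕ, 0 < j → j ≤ 6 → (j : ZMod n) ≠ 0) {x z : ZMod n}
    (hz : z ∉ ({-3, -2, -1, 0, 1, 2, 3, 4} : Finset (ZMod n))) :
    IsCutClosed 2 3 (insert (x + z) (block 2 3 x)) := by
  intro y hy hy'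
  obtain rfl := eq_of_mem_insert_block_two_three h hz hy hy'
  simp [mem_block]

theorem card_displacements_two_three {n : ℕ} :
    ({-3, -2, -1, 0, 1, 2, 3, 4} : Finset (ZMod n)).card ≤ 8 := by
  have := List.toFinset_card_le ([-3, -2, -1, 0, 1, 2, 3, 4] : List (ZMod n))
  simpa using this

theorem le_closedCount_two_three_four {n : ℕ} [NeZero n] (hn : 8 < n)
    (h : ∀ j : ℕ, 0 < j → j ≤ 6 → (j : ZMod n) ≠ 0) :
    avoidCount (3 - 2 : ZMod n) 4 + n ≤ closedCount (2 : ZMod n) 3 4 := by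
  classical
  have h1 := h 1 (by norm_num) (by norm_num)
  have h2 := h 2 (by norm_num) (by norm_num)
  have h3 := h 3 (by norm_num) (by norm_num)
  have h5 := h 5 (by norm_num) (by norm_num)
  push_cast at h1 h2 h3 h5
  -- Any admissible fifth vertex will do; it only serves to reuse the uniqueness statement for the
  -- bare block.
  obtain ⟨z, hz⟩ : ∃ z, z ∉ ({-3, -2, -1, 0, 1, 2, 3, 4} : Finset (ZMod n)) := by
    by_contra! hall
    have := Finset.card_le_card fun (y : ZMod n) (_ : y ∈ Finset.univ) => hall y
    rw [Finset.card_univ, ZMod.card] at this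
    exact absurd (this.trans card_displacements_two_three) (by omega)
  have huniq : ∀ x y : ZMod n, y ∈ block 2 3 x → y + (3 - 2) ∈ block 2 3 x → y = x :=
    fun x y hy hy' => eq_of_mem_insert_block_two_three h hz (Finset.mem_insert_of_mem hy)
      (Finset.mem_insert_of_mem hy')
  have hinj : Function.Injective (block (2 : ZMod n) 3) := by
    intro x y hxy
    refine huniq y x ?_ ?_ <;> rw [← hxy] <;> simp [mem_block]
  have hdisj : Disjoint (cardFamily 4 (AvoidsDiff (3 - 2 : ZMod n)))
      (Finset.univ.image (block (2 : ZMod n) 3)) := by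
    rw [Finset.disjoint_left]
    intro S hS hS'
    obtain ⟨x, -, rfl⟩ := Finset.mem_image.1 hS'
    exact (mem_cardFamily.1 hS).2 x (by simp [mem_block]) (by simp [mem_block])
  have hcard : (Finset.univ.image (block (2 : ZMod n) 3)).card = n := by
    rw [Finset.card_image_of_injective _ hinj, Finset.card_univ, ZMod.card]
  refine (Nat.add_le_add_left hcard.ge _).trans ?_
  rw [avoidCount, ← Finset.card_union_of_disjoint hdisj]
  refine Finset.card_le_card fun S hS => ?_
  rw [Finset.mem_union, mem_cardFamily] at hS
  rw [mem_cardFamily]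
  rcases hS with hS | hS
  · exact ⟨hS.1, fun x hx hxd => absurd hxd (hS.2 x hx)⟩
  · obtain ⟨x, -, rfl⟩ := Finset.mem_image.1 hS
    refine ⟨card_block h2 h3 (fun e => h1 (by linear_combination -e))
      (fun e => h5 (by linear_combination e)) x, fun y hy hy' => ?_⟩
    obtain rfl := huniq x y hy hy'
    simp [mem_block]

theorem le_closedCount_two_three_five {n : ℕ} [NeZero n]
    (h : ∀ j : ℕ, 0 < j → j ≤ 6 → (j : ZMod n) ≠ 0) :
    avoidCount (3 - 2 : ZMod n) 5 + n * (n - 8) ≤ closedCount (2 : ZMod n) 3 5 := by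
  classical
  have h1 := h 1 (by norm_num) (by norm_num)
  have h2 := h 2 (by norm_num) (by norm_num)
  have h3 := h 3 (by norm_num) (by norm_num)
  have h5 := h 5 (by norm_num) (by norm_num)
  push_cast at h1 h2 h3 h5
  set F : Finset (ZMod n) := {-3, -2, -1, 0, 1, 2, 3, 4} with hF
  set f : ZMod n × ZMod n → Finset (ZMod n) := fun p => insert (p.1 + p.2) (block 2 3 p.1) with hf
  have hnot : ∀ x z, z ∉ F → x + z ∉ block 2 3 x := by
    intro x z hz hmem
    rw [mem_block] at hmem
    simp only [hF, Finset.mem_insert, Finset.mem_singleton, not_or] at hz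
    obtain ⟨-, z2, -, z4, z5, -, z7, -⟩ := hz
    rcases hmem with e | e | e | e
    · exact z4 (by linear_combination e)
    · exact z5 (by linear_combination e)
    · exact z2 (by linear_combination e)
    · exact z7 (by linear_combination e)
  have hinj : Set.InjOn f ((Finset.univ ×ˢ Fᶜ : Finset (ZMod n × ZMod n)) : Set _) := by
    rintro ⟨x, z⟩ hp ⟨y, w⟩ hq hxy
    simp only [Finset.coe_product, Set.mem_prod, Finset.mem_coe, Finset.mem_compl, hf] at hp hq hxy
    have hxy' : x = y := by
      refine eq_of_mem_insert_block_two_three h hq.2 (y := x) ?_ ?_ <;> rw [← hxy] <;>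
        simp [mem_block]
    subst hxy'
    have hmem : x + z ∈ insert (x + w) (block 2 3 x) := hxy ▸ Finset.mem_insert_self _ _
    rcases Finset.mem_insert.1 hmem with e | e
    · rw [add_left_cancel e]
    · exact absurd e (hnot x z hp.2)
  have hdisj : Disjoint (cardFamily 5 (AvoidsDiff (3 - 2 : ZMod n)))
      ((Finset.univ ×ˢ Fᶜ).image f) := by
    rw [Finset.disjoint_left]
    intro S hS hS'
    obtain ⟨⟨x, z⟩, -, rfl⟩ := Finset.mem_image.1 hS'
    exact (mem_cardFamily.1 hS).2 x (by simp [hf, mem_block]) (by simp [hf, mem_block])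
  have hcard : n * (n - 8) ≤ ((Finset.univ ×ˢ Fᶜ).image f).card := by
    rw [Finset.card_image_of_injOn hinj, Finset.card_product, Finset.card_univ, Finset.card_compl,
      ZMod.card]
    have : F.card ≤ 8 := card_displacements_two_three
    exact Nat.mul_le_mul_left _ (by omega)
  refine (Nat.add_le_add_left hcard _).trans ?_
  rw [avoidCount, ← Finset.card_union_of_disjoint hdisj]
  refine Finset.card_le_card fun S hS => ?_
  rw [Finset.mem_union, mem_cardFamily] at hS
  rw [mem_cardFamily]
  rcases hS with hS | hS
  · exact ⟨hS.1, fun x hx hxd => absurd hxd (hS.2 x hx)⟩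
  · obtain ⟨⟨x, z⟩, hp, rfl⟩ := Finset.mem_image.1 hS
    have hz : z ∉ F := by simpa using hp
    refine ⟨?_, isCutClosed_insert_block_two_three h hz⟩
    rw [Finset.card_insert_of_notMem (hnot x z hz), card_block h2 h3
      (fun e => h1 (by linear_combination -e)) (fun e => h5 (by linear_combination e))]

theorem image_range_five_subset {n : ℕ} {c : ZMod n} {S : Finset (ZMod n)}
    (hS : ∀ k : ℕ, c + 3 * k ∈ S) :
    (Finset.range 5).image (fun k : ℕ => c + 3 * (k : ZMod n)) ⊆ S := by
  intro y hy
  obtain ⟨k, -, rfl⟩ := Finset.mem_image.1 hy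
  exact hS k

theorem card_image_range_five {n : ℕ} (hn : 12 < n) (c : ZMod n) :
    ((Finset.range 5).image (fun k : ℕ => c + 3 * (k : ZMod n))).card = 5 := by
  rw [Finset.card_image_of_injOn, Finset.card_range]
  intro k hk l hl hkl
  rw [Finset.coe_range, Set.mem_Iio] at hk hl
  have h1 : ((3 * k : ℕ) : ZMod n) = ((3 * l : ℕ) : ZMod n) := by
    push_cast
    exact add_left_cancel hkl
  rw [ZMod.natCast_eq_natCast_iff'] at h1
  rw [Nat.mod_eq_of_lt (by omega), Nat.mod_eq_of_lt (by omega)] at h1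
  omega

theorem closedCount_le_strongCutCount_two_three {n : ℕ} [NeZero n] (hn : 12 < n) {k : ℕ}
    (hk : k ≤ 4) : closedCount (2 : ZMod n) 3 k ≤ strongCutCount (circulant n {2, 3}) k := by
  rw [strongCutCount_eq_card_cardFamily]
  refine Finset.card_le_card fun S hS => ?_
  rw [mem_cardFamily] at hS ⊢
  refine ⟨hS.1, ?_⟩
  rcases isStronglyConnected_or_coset (by omega) hS.2 (by omega) with h | ⟨c, hc⟩
  · exact h
  · have := Finset.card_le_card (image_range_five_subset fun k => (hc k).1)
    rw [card_image_range_five hn] at this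
    omega

/-- Only cosets of the subgroup generated by 3 are lost. A five-element one is an orbit of five
steps of 3, and starting residues 0, 1, 2 give at most three of them. -/
theorem closedCount_five_le_strongCutCount_two_three {n : ℕ} [NeZero n] (hn : 12 < n)
    (hthree : 3 ∣ n) :
    closedCount (2 : ZMod n) 3 5 ≤ strongCutCount (circulant n {2, 3}) 5 + 3 := by
  classical
  rw [strongCutCount_eq_card_cardFamily]
  have hsub : cardFamily 5 (IsCutClosed (2 : ZMod n) 3) ⊆
      (cardFamily 5 fun S : Finset (ZMod n) =>
        IsStronglyConnected (inducedSubdigraph (circulant n {2, 3}) Sᶜ)) ∪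
      (Finset.range 3).image fun r : ℕ =>
        (Finset.range 5).image fun k : ℕ => (r : ZMod n) + 3 * (k : ZMod n) := by
    intro S hS
    rw [mem_cardFamily] at hS
    rw [Finset.mem_union, mem_cardFamily]
    rcases isStronglyConnected_or_coset (by omega) hS.2 (by omega) with h | ⟨c, hc⟩
    · exact .inl ⟨hS.1, h⟩
    · right
      obtain ⟨m, hm⟩ := hthree
      have hlt := ZMod.val_lt c
      refine Finset.mem_image.2 ⟨c.val % 3, by simp [Nat.mod_lt], ?_⟩
      refine Finset.eq_of_subset_of_card_le (image_range_five_subset fun k => ?_) ?_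
      · have hr : ((c.val % 3 : ℕ) : ZMod n) = c + 3 * ((m - c.val / 3 : ℕ) : ZMod n) := by
          have h1 : c.val + 3 * (m - c.val / 3) = c.val % 3 + n := by omega
          have h2 := congrArg (Nat.cast : ℕ → ZMod n) h1
          rw [Nat.cast_add, Nat.cast_add, Nat.cast_mul, ZMod.natCast_self, ZMod.natCast_zmod_val,
            add_zero] at h2
          exact h2.symm
        rw [hr, add_assoc, ← mul_add, ← Nat.cast_add]
        exact (hc _).1
      · rw [hS.1, card_image_range_five hn]
  refine (Finset.card_le_card hsub).trans ((Finset.card_union_le _ _).trans ?_)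
  exact Nat.add_le_add_left (Finset.card_image_le.trans (by simp)) _

/-! ### Comparison of {2, 3} with each possible connection set. -/

theorem isUnit_two_of_odd {n : ℕ} (hodd : Odd n) : IsUnit (2 : ZMod n) := by
  simpa using (ZMod.isUnit_iff_coprime 2 n).2 (Nat.coprime_two_left.2 hodd)

theorem two_mul_ne_zero_of_odd {n : ℕ} (hodd : Odd n) {x : ZMod n} (hx : x ≠ 0) : 2 * x ≠ 0 :=
  fun h => hx ((isUnit_two_of_odd hodd).mul_right_eq_zero.1 h)

theorem exists_mul_add_mul_eq_one {n : ℕ} {a b : ZMod n}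
    (h : AddSubgroup.closure ({a, b} : Set (ZMod n)) = ⊤) : ∃ r s : ZMod n, r * a + s * b = 1 := by
  have h1 : (1 : ZMod n) ∈ AddSubgroup.closure ({a, b} : Set (ZMod n)) := h ▸ AddSubgroup.mem_top _
  obtain ⟨r, s, hrs⟩ := AddSubgroup.mem_closure_pair.1 h1
  exact ⟨r, s, by simpa using hrs⟩

/-- In the bidirected cycle, removing the ends of a path with two inner vertices separates them. -/
theorem strongCutCount_two_lt_of_neg {n : ℕ} [NeZero n] (hn : 5 < n) {a : ZMod n}
    (ha : IsUnit a) : strongCutCount (circulant n {a, -a}) 2 < avoidCount (-a - a) 2 := by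
  have h1 := natCast_mul_ne_zero ha (j := 1) (by norm_num) (by omega)
  have h2 := natCast_mul_ne_zero ha (j := 2) (by norm_num) (by omega)
  have h3 := natCast_mul_ne_zero ha (j := 3) (by norm_num) (by omega)
  have h4 := natCast_mul_ne_zero ha (j := 4) (by norm_num) (by omega)
  have h5 := natCast_mul_ne_zero ha (j := 5) (by norm_num) (by omega)
  push_cast at h1 h2 h3 h4 h5
  rw [one_mul] at h1
  rw [strongCutCount_eq_card_cardFamily, avoidCount]
  refine Finset.card_lt_card (Finset.ssubset_iff_of_subset ?_ |>.2 ⟨{0, 3 * a}, ?_, ?_⟩)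
  · intro S hS
    rw [mem_cardFamily] at hS ⊢
    refine ⟨hS.1, (isCutClosed_of_isStronglyConnected (by omega) hS.2).avoidsDiff_of_card_le_two h1
      (neg_ne_zero.2 h1) (fun e => h2 (by linear_combination e)) hS.1.le⟩
  · rw [mem_cardFamily]
    refine ⟨Finset.card_pair h3.symm, fun x hx hxd => ?_⟩
    simp only [Finset.mem_insert, Finset.mem_singleton] at hx hxd
    rcases hx with rfl | rfl <;> rcases hxd with e | e
    · exact h2 (by linear_combination -e)
    · exact h5 (by linear_combination -e)
    · exact h1 (by linear_combination e)
    · exact h2 (by linear_combination -e)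
  · rw [mem_cardFamily]
    rintro ⟨-, hstr⟩
    have ma : a ∈ ({0, 3 * a} : Finset (ZMod n))ᶜ := by
      simp only [Finset.mem_compl, Finset.mem_insert, Finset.mem_singleton, not_or]
      exact ⟨h1, fun e => h2 (by linear_combination -e)⟩
    have mv : 4 * a ∈ ({0, 3 * a} : Finset (ZMod n))ᶜ := by
      simp only [Finset.mem_compl, Finset.mem_insert, Finset.mem_singleton, not_or]
      exact ⟨h4, fun e => h1 (by linear_combination e)⟩
    have hreach : ∀ v, Relation.ReflTransGen
        (inducedSubdigraph (circulant n {a, -a}) ({0, 3 * a} : Finset (ZMod n))ᶜ).Adj ⟨a, ma⟩ v →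
        v.1 = a ∨ v.1 = 2 * a := by
      intro v hv
      induction hv with
      | refl => exact .inl rfl
      | @tail u v _ huv ih =>
        have hv := v.2
        simp only [Finset.mem_compl, Finset.mem_insert, Finset.mem_singleton, not_or] at hv
        have huv : v.1 - u.1 = a ∨ v.1 - u.1 = -a := huv
        rcases ih with e | e <;> rcases huv with e' | e'
        · exact .inr (by linear_combination e + e')
        · exact absurd (by linear_combination e + e') hv.1
        · exact absurd (by linear_combination e + e') hv.2
        · exact .inl (by linear_combination e + e')
    rcases hreach _ (hstr.2 ⟨a, ma⟩ ⟨4 * a, mv⟩) with e | e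
    · exact h3 (by linear_combination e)
    · exact h2 (by linear_combination e)

section Comparison

open Filter Topology

variable {n : ℕ} [NeZero n]

/-- `Γ(ℤ_n, {a, b})` is eventually at most as reliable as `Γ(ℤ_n, {2, 3})` if it has few closed
five-element sets. -/
theorem eventually_le_two_three_of_closedCount_five (hodd : Odd n) (hthree : 3 ∣ n) (hn : 9 < n)
    {a b : ZMod n} (ha : a ≠ 0) (hb : b ≠ 0) (hab : a ≠ b) (hs : a + b ≠ 0)
    (h5 : 3 * (b - a) ≠ 0 → closedCount a b 5 ≤ avoidCount (b - a) 5 + n * (n - 9)) :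
    ∀ᶠ p in 𝓝[≤] (1 : ℝ),
      nodeReliability (circulant n {a, b}) p ≤ nodeReliability (circulant n {2, 3}) p := by
  -- The least odd multiple of 3 above 9; the final numerical comparison depends on this bound.
  have hn15 : 15 ≤ n := by
    obtain ⟨m, rfl⟩ := hodd
    omega
  have hcast : ∀ j : ℕ, 0 < j → j ≤ 6 → (j : ZMod n) ≠ 0 := fun j h1 h2 => by
    simpa using natCast_mul_ne_zero (isUnit_one (M := ZMod n)) h1 (by omega)
  have two : ∀ x : ZMod n, x ≠ 0 → 2 * x ≠ 0 := fun _ => two_mul_ne_zero_of_odd hodd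
  have hd : b - a ≠ 0 := sub_ne_zero.2 hab.symm
  have hd2 := two _ hd
  have e1 : (3 - 2 : ZMod n) = 1 := by norm_num
  have i1 : (3 - 2 : ZMod n) ≠ 0 := by
    rw [e1]
    simpa using hcast 1 (by norm_num) (by norm_num)
  have i2 : 2 * (3 - 2 : ZMod n) ≠ 0 := two _ i1
  have i3 : 3 * (3 - 2 : ZMod n) ≠ 0 := by
    rw [e1, mul_one]
    simpa using hcast 3 (by norm_num) (by norm_num)
  have i4 : 4 * (3 - 2 : ZMod n) ≠ 0 := fun h => two _ i2 (by linear_combination h)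
  have hG : ∀ k ≤ 4, avoidCount (3 - 2 : ZMod n) k ≤ strongCutCount (circulant n {2, 3}) k :=
    fun k hk => (avoidCount_le_closedCount 2 3 k).trans
      (closedCount_le_strongCutCount_two_three (by omega) hk)
  have hH : ∀ k ≤ 3, strongCutCount (circulant n {a, b}) k ≤ avoidCount (b - a) k :=
    fun k hk => (strongCutCount_le_closedCount a b (by omega)).trans
      (closedCount_le_avoidCount_of_le_three ha hb hab hs hk)
  -- Order three is decided at `k = 3`, every larger order at `k = 5`.
  by_cases hd3 : 3 * (b - a) = 0
  · have a2 : avoidCount (b - a) 2 = avoidCount (3 - 2 : ZMod n) 2 := by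
      have := two_mul_avoidCount_two hd hd2
      have := two_mul_avoidCount_two i1 i2
      omega
    refine eventually_nodeReliability_le 3 (by rw [ZMod.card]; omega) (fun j hj => ?_) ?_
    · refine (hH j (by omega)).trans (le_trans (le_of_eq ?_) (hG j (by omega)))
      interval_cases j
      · rw [avoidCount_zero, avoidCount_zero]
      · rw [avoidCount_one hd, avoidCount_one i1]
      · exact a2
    · refine (hH 3 le_rfl).trans_lt (lt_of_lt_of_le ?_ (hG 3 (by norm_num)))
      have r1 := avoidCount_three_of_three_mul_eq_zero hd hd3
      have r2 := (avoidCount_recurrences (by omega) i1 i2 i3 i4).1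
      rw [a2] at r1
      omega
  · have hd4 : 4 * (b - a) ≠ 0 := fun h => two _ hd2 (by linear_combination h)
    obtain ⟨c4, c5⟩ := avoidCount_comparison (by omega) hd hd2 hd3 hd4 i1 i2 i3 i4
    refine eventually_nodeReliability_le 5 (by rw [ZMod.card]; omega) (fun j hj => ?_) ?_
    · obtain hj | rfl : j ≤ 3 ∨ j = 4 := by omega
      · exact (hH j hj).trans ((c4 j (by omega)).le.trans (hG j (by omega)))
      · calc strongCutCount (circulant n {a, b}) 4 ≤ closedCount a b 4 :=
              strongCutCount_le_closedCount a b (by omega)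
          _ ≤ avoidCount (b - a) 4 + n := closedCount_four_le ha hb hab hs
          _ = avoidCount (3 - 2 : ZMod n) 4 + n := by rw [c4 4 le_rfl]
          _ ≤ closedCount (2 : ZMod n) 3 4 := le_closedCount_two_three_four (by omega) hcast
          _ ≤ _ := closedCount_le_strongCutCount_two_three (by omega) le_rfl
    · have k1 := strongCutCount_le_closedCount a b (k := 5) (by omega)
      have k2 := h5 hd3
      have k3 := le_closedCount_two_three_five hcast
      have k4 := closedCount_five_le_strongCutCount_two_three (by omega) hthree
      -- The extra `n` outweighs the possible deficit `n / 5` in avoiding sets plus the three lost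
      -- cosets.
      have k5 : n * (n - 8) = n * (n - 9) + n := by
        rw [show n - 8 = n - 9 + 1 by omega]
        ring
      omega

theorem eventually_le_two_three_of_neg (hodd : Odd n) (hn : 12 < n) {a : ZMod n}
    (ha : IsUnit a) : ∀ᶠ p in 𝓝[≤] (1 : ℝ),
      nodeReliability (circulant n {a, -a}) p ≤ nodeReliability (circulant n {2, 3}) p := by
  have h1 : a ≠ 0 := by simpa using natCast_mul_ne_zero ha (j := 1) (by norm_num) (by omega)
  have h2 : 2 * a ≠ 0 := two_mul_ne_zero_of_odd hodd h1
  have hd : -a - a ≠ 0 := fun h => h2 (by linear_combination -h)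
  have hd2 := two_mul_ne_zero_of_odd hodd hd
  have i1 : (3 - 2 : ZMod n) ≠ 0 := by
    have := natCast_mul_ne_zero (isUnit_one (M := ZMod n)) (j := 1) (by norm_num) (by omega)
    intro h
    exact this (by push_cast; linear_combination h)
  have i2 := two_mul_ne_zero_of_odd hodd i1
  have hG : ∀ k ≤ 2, avoidCount (3 - 2 : ZMod n) k ≤ strongCutCount (circulant n {2, 3}) k :=
    fun k hk => (avoidCount_le_closedCount 2 3 k).trans
      (closedCount_le_strongCutCount_two_three (by omega) (by omega))
  refine eventually_nodeReliability_le 2 (by rw [ZMod.card]; omega) (fun j hj => ?_) ?_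
  · refine (strongCutCount_le_closedCount a (-a) (by omega)).trans
      ((closedCount_le_avoidCount_of_le_two h1 (neg_ne_zero.2 h1)
        (fun e => h2 (by linear_combination e)) hj.le).trans
        (le_trans (le_of_eq ?_) (hG j (by omega))))
    interval_cases j
    · rw [avoidCount_zero, avoidCount_zero]
    · rw [avoidCount_one hd, avoidCount_one i1]
  · refine (strongCutCount_two_lt_of_neg (by omega) ha).trans_le (le_trans ?_ (hG 2 le_rfl))
    have := two_mul_avoidCount_two hd hd2
    have := two_mul_avoidCount_two i1 i2
    omega

/-- From `3 * a = 2 * b` one gets `a = 2 * (b - a)` and `b = 3 * (b - a)`; since `a`, `b` generate,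
`b - a` is a unit. -/
theorem nodeReliability_eq_two_three {a b : ZMod n}
    (h : AddSubgroup.closure ({a, b} : Set (ZMod n)) = ⊤) (hab : 3 * a = 2 * b) (p : ℝ) :
    nodeReliability (circulant n {a, b}) p = nodeReliability (circulant n {2, 3}) p := by
  obtain ⟨r, s, hrs⟩ := exists_mul_add_mul_eq_one h
  have hu : IsUnit (b - a) :=
    IsUnit.of_mul_eq_one (2 * r + 3 * s) (by linear_combination hrs + (-r - s) * hab)
  obtain ⟨u, hu⟩ := hu
  rw [← nodeReliability_circulant_unit_mul u 2 3, hu]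
  congr 3
  · linear_combination hab
  · congr 1
    linear_combination hab

theorem eventually_le_two_three_of_double (hodd : Odd n) (hthree : 3 ∣ n) (hn : 9 < n)
    {a : ZMod n} (ha : IsUnit a) : ∀ᶠ p in 𝓝[≤] (1 : ℝ),
      nodeReliability (circulant n {a, 2 * a}) p ≤ nodeReliability (circulant n {2, 3}) p := by
  have h : ∀ j : ℕ, 0 < j → j ≤ 9 → (j : ZMod n) * a ≠ 0 := fun j h1 h2 =>
    natCast_mul_ne_zero ha h1 (by omega)
  have h1 := h 1 (by norm_num) (by norm_num)
  have h2 := h 2 (by norm_num) (by norm_num)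
  have h3 := h 3 (by norm_num) (by norm_num)
  have h4 := h 4 (by norm_num) (by norm_num)
  have h5 := h 5 (by norm_num) (by norm_num)
  push_cast at h1 h2 h3 h4 h5
  rw [one_mul] at h1
  exact eventually_le_two_three_of_closedCount_five hodd hthree hn h1 h2
    (fun e => h1 (by linear_combination -e)) (fun e => h3 (by linear_combination e))
    fun _ => closedCount_five_le_of_double hn.le h1 h2 h3 h4 h5

theorem eventually_le_two_three_of_neg_double (hodd : Odd n) (hthree : 3 ∣ n) (hn : 9 < n)
    {a : ZMod n} (ha : IsUnit a) : ∀ᶠ p in 𝓝[≤] (1 : ℝ),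
      nodeReliability (circulant n {a, -2 * a}) p ≤ nodeReliability (circulant n {2, 3}) p := by
  have h : ∀ j : ℕ, 0 < j → j ≤ 9 → (j : ZMod n) * a ≠ 0 := fun j h1 h2 =>
    natCast_mul_ne_zero ha h1 (by omega)
  have h1 := h 1 (by norm_num) (by norm_num)
  have h2 := h 2 (by norm_num) (by norm_num)
  have h3 := h 3 (by norm_num) (by norm_num)
  push_cast at h1 h2 h3
  rw [one_mul] at h1
  exact eventually_le_two_three_of_closedCount_five hodd hthree hn h1
    (fun e => h2 (by linear_combination -e)) (fun e => h3 (by linear_combination e))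
    (fun e => h1 (by linear_combination -e)) fun _ => closedCount_five_le_of_neg_double h

/-- `Γ(ℤ_n, {2, 3})` is eventually at least as reliable as every directed circulant graph with a
two-element generating set. -/
theorem eventually_le_two_three (hodd : Odd n) (hthree : 3 ∣ n) (hn : 9 < n) {a b : ZMod n}
    (hab : a ≠ b) (hgen : IsGeneratingSet ({a, b} : Set (ZMod n))) : ∀ᶠ p in 𝓝[≤] (1 : ℝ),
      nodeReliability (circulant n {a, b}) p ≤ nodeReliability (circulant n {2, 3}) p := by
  obtain ⟨h0, htop⟩ := hgen
  have ha : a ≠ 0 := fun h => h0 (by simp [h])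
  have hb : b ≠ 0 := fun h => h0 (by simp [h])
  obtain ⟨r, s, hrs⟩ := exists_mul_add_mul_eq_one htop
  have unit_a : ∀ c, b = c * a → IsUnit a := fun c hc =>
    IsUnit.of_mul_eq_one (r + s * c) (by linear_combination hrs - s * hc)
  have unit_b : ∀ c, a = c * b → IsUnit b := fun c hc =>
    IsUnit.of_mul_eq_one (r * c + s) (by linear_combination hrs - r * hc)
  by_cases hs : a + b = 0
  · obtain rfl : b = -a := by linear_combination hs
    obtain ⟨m, hm⟩ := hodd
    exact eventually_le_two_three_of_neg ⟨m, hm⟩ (by omega) (unit_a (-1) (by ring))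
  -- The two relations giving graphs isomorphic to Γ(ℤ_n, {2, 3}) come first; the remaining small
  -- relations then give strictly worse graphs.
  by_cases r5 : 3 * a = 2 * b
  · exact .of_forall fun p => (nodeReliability_eq_two_three htop r5 p).le
  by_cases r6 : 3 * b = 2 * a
  · rw [Set.pair_comm] at htop ⊢
    exact .of_forall fun p => (nodeReliability_eq_two_three htop r6 p).le
  by_cases r1 : b = 2 * a
  · subst r1
    exact eventually_le_two_three_of_double hodd hthree hn (unit_a 2 rfl)
  by_cases r2 : a = 2 * b
  · subst r2
    rw [Set.pair_comm]
    exact eventually_le_two_three_of_double hodd hthree hn (unit_b 2 rfl)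
  by_cases r3 : b = -2 * a
  · subst r3
    exact eventually_le_two_three_of_neg_double hodd hthree hn (unit_a (-2) rfl)
  by_cases r4 : a = -2 * b
  · subst r4
    rw [Set.pair_comm]
    exact eventually_le_two_three_of_neg_double hodd hthree hn (unit_b (-2) rfl)
  refine eventually_le_two_three_of_closedCount_five hodd hthree hn ha hb hab hs fun hd3 => ?_
  have two : ∀ x : ZMod n, x ≠ 0 → 2 * x ≠ 0 := fun _ => two_mul_ne_zero_of_odd hodd
  have hd : b - a ≠ 0 := sub_ne_zero.2 hab.symm
  exact closedCount_five_le_of_generic ha hb hd hs (two _ ha) (two _ hb) (two _ hd) hd3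
    (sub_ne_zero.2 r1) (sub_ne_zero.2 r2) (fun e => r3 (by linear_combination e))
    (fun e => r4 (by linear_combination e)) (sub_ne_zero.2 r5) (sub_ne_zero.2 r6)
    (fun e => two _ (two _ (two _ ha)) (by linear_combination e))

end Comparison

end SCNodeRel

theorem mainTheorem6 (n : ℕ) [NeZero n] (hodd : Odd n) (hthree : 3 ∣ n) (hn : 9 < n) :
    SCNodeRel.IsOptimallyGreatestNear (SCNodeRel.twoCirculants n) 1
      (SCNodeRel.circulant n {1, 3 * (2 : ZMod n)⁻¹}) := by
  have hinv : (2 : ZMod n) * 2⁻¹ = 1 := by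
    simpa using ZMod.coe_mul_inv_eq_one (n := n) 2 (Nat.coprime_two_left.2 hodd)
  generalize (2 : ZMod n)⁻¹ = h at hinv ⊢
  have hcast : ∀ j : ℕ, 0 < j → j < n → (j : ZMod n) ≠ 0 := fun j h1 h2 => by
    simpa using SCNodeRel.natCast_mul_ne_zero (isUnit_one (M := ZMod n)) h1 h2
  have h1 := hcast 1 (by norm_num) (by omega)
  have h3 := hcast 3 (by norm_num) (by omega)
  push_cast at h1 h3
  have hgen : SCNodeRel.IsGeneratingSet ({1, 3 * h} : Set (ZMod n)) := by
    refine ⟨?_, ?_⟩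
    · rintro (e | e)
      · exact h1 e.symm
      · have e : (0 : ZMod n) = 3 * h := e
        exact h3 (by linear_combination -3 * hinv - 2 * e)
    · rw [eq_top_iff]
      intro x _
      have := AddSubgroup.nsmul_mem (AddSubgroup.closure ({1, 3 * h} : Set (ZMod n)))
        (AddSubgroup.subset_closure (Set.mem_insert _ _)) x.val
      simpa using this
  have hne : (1 : ZMod n) ≠ 3 * h := fun e => h1 (by linear_combination -3 * hinv - 2 * e)
  refine SCNodeRel.isOptimallyGreatestNear_one_of_eventually ?_ ⟨1, 3 * h, hne, hgen, rfl⟩ ?_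
  · refine (Set.finite_range fun p : ZMod n × ZMod n =>
      SCNodeRel.circulant n {p.1, p.2}).subset ?_
    rintro _ ⟨a, b, -, -, rfl⟩
    exact ⟨(a, b), rfl⟩
  · rintro _ ⟨a, b, hab, hg, rfl⟩
    filter_upwards [SCNodeRel.eventually_le_two_three hodd hthree hn hab hg] with p hp
    -- Here `3 * 1 = 2 * (3 * h)`, because `h` is the inverse of 2.
    rwa [SCNodeRel.nodeReliability_eq_two_three hgen.2 (by linear_combination -3 * hinv)]
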